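/- **Setting.** Let $(X,d)$ be a finite metric space with $|X|>1$. A *marked DAG over $X$* is a triple $\hat D=(D,\omega,\theta)$, where $D=(V,A)$ is a finite directed acyclic graph with $X\subseteq V$, with a single source $r$, and whose set of sinks is $X$; the arc lengths $\omega_{uv}>0$ satisfy $\omega_{uv}>\omega_{vw}$ whenever $uv,vw\in A$; and $\theta_{uv}>0$ with $\sum_{v:uv\in A}\theta_{uv}=1$ for all $u\in V\setminus X$. Put $\eta_{uv}=1+\log(1/\theta_{uv})$ and $\delta_{uv}=\theta_{uv}/\eta_{uv}$. Let $\mathcal P$ be the set of directed paths from $r$ to a sink, $\bar\gamma\in X$ the endpoint of $\gamma\in\mathcal P$, $\Delta_0$ the maximum number of arcs of a path in $\mathcal P$, and $\sigma(u)$ the number of directed paths from $u$ to a sink (so $\sigma(x)=1$ for $x\in X$ and $\sigma(r)=|\mathcal P|$). For distinct $\gamma_1,\gamma_2\in\mathcal P$ that first diverge at $u$, along arcs $uv_1\ne uv_2$, let $d_{\hat D}(\gamma_1,\gamma_2)=\max(\omega_{uv_1},\omega_{uv_2})$, and let $d_{\hat D}(\gamma,\gamma)=0$. A *unit flow* is $F\in\mathbb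 R_{\ge0}^A$ with $\sum_{v:uv\in A}F_{uv}=\sum_{v:vu\in A}F_{vu}$ for all $u\in V\setminus(X\cup\{r\})$ and $\sum_{v:rv\in A}F_{rv}=1$. With $F_u=\sum_{v:uv\in A}F_{uv}$ it defines the probability distribution $\gamma\mapsto\prod_{uv\in\gamma}F_{uv}/F_u$ on $\mathcal P$ (paths through a vertex $u$ with $F_u=0$ have probability $0$). Let $\mathbb W^1_{\hat D}(F,F')$ be the $L^1$-transportation cost between the distributions of $F$ and $F'$ with respect to $d_{\hat D}$. The marked DAG is *$\tau$-geometric* if $\omega_{uv}\ge\tau\,\omega_{vw}$ for all consecutive arcs $uv,vw\in A$; *$1$-expanding* if $d_{\hat D}(\gamma_1,\gamma_2)\ge d(\bar\gamma_1,\bar\gamma_2)$ for all $\gamma_1,\gamma_2\in\mathcal P$; and *$L$-Lipschitz* if for every sequence $x_1,\dots,x_m\in X$ there are unit flows $F^{(1)},\dots,F^{(m)}$ such that the flow of $F^{(i)}$ into $x_i$ is $1$ for every $i$ and $\sum_{i<m}\mathbb W^1_{\hat D}(F^{(i)},F^{(i+1)})\le L\sum_{i<m}d(x_i,x_{i+1})$.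 **Algorithm.** Let $\kappa>0$. A *state* is $q\in\mathbb R_{\ge0}^A$ with $\sum_{v:uv\in A}q_{uv}=1$ for all $u\in V\setminus X$; write $q^{(u)}=(q_{uv})_{v:uv\in A}$, and let $Q^{(u)}$ be the probability simplex on the arcs leaving $u$. Let $$\mathbb D^{(u)}(p\,\|\,p')=\frac1\kappa\sum_{v:uv\in A}\frac{\omega_{uv}}{\eta_{uv}}\Big[(p_{uv}+\delta_{uv})\log\frac{p_{uv}+\delta_{uv}}{p'_{uv}+\delta_{uv}}+p'_{uv}-p_{uv}\Big].$$ For a state $q$ and a cost vector $c\in\mathbb R_{\ge0}^X$ the state $p=\mathcal A(q,c)$ is computed from the sinks upwards: $\hat c_x=c_x$ for $x\in X$, and, for $u\in V\setminus X$ (after all heads of arcs leaving $u$), $p^{(u)}$ is the unique minimiser over $p'\in Q^{(u)}$ of $\mathbb D^{(u)}(p'\,\|\,q^{(u)})+\sum_{v:uv\in A}p'_{uv}\hat c_v$, and $\hat c_u=\sum_{v:uv\in A}p_{uv}\hat c_v$. Given an initial state $p_0$ and cost vectors $c_1,c_2,\dots$, let $p_t=\mathcal A(p_{t-1},c_t)$.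 Let $\Lambda(q)$ be the unique unit flow $F$ with $F_{uv}=F_uq_{uv}$ on all arcs, and let $\mu_t(x)$ be the flow of $\Lambda(p_t)$ into $x\in X$; at time $t$ the algorithm plays the distribution $\mu_t$ on $X$. Its service cost is $\mathsf{serv}=\sum_{t\ge1}\sum_{x\in X}c_t(x)\mu_t(x)$ and its movement cost is $\mathsf{move}=\sum_{t\ge1}\mathbb W^1_{\hat D}(\Lambda(p_{t-1}),\Lambda(p_t))$. Let also $\mathsf{move}_X=\sum_{t\ge1}\mathbb W^1_X(\mu_{t-1},\mu_t)$, with $\mathbb W^1_X$ the $L^1$-transportation cost on $(X,d)$, and, for $\rho_0\in X$, let $\mathsf{cost}^*$ be the infimum of $\sum_{t\ge1}[c_t(\rho_t)+d(\rho_{t-1},\rho_t)]$ over all sequences $\rho_1,\rho_2,\dots$ in $X$ (all costs take values in $[0,\infty]$). **Theorem 4.2.** There are universal constants $a,b,C>0$ such that the following holds. Let $\hat D$ be a $\tau$-geometric marked DAG over $X$, for some $\tau\ge4$, such that $\theta_{uv}=\sigma(v)/\sigma(u)$ for every arc $uv$. If $\hat D$ is $1$-expanding and $L$-Lipschitz with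 respect to $(X,d)$, then there are $\kappa>0$ with $aL\le\kappa\le bL$ and $\epsilon>0$ such that for every initial state $p_0$ and every $\rho_0\in X$ there is $\beta>0$ such that for all sequences $c_1,c_2,\dots\in\mathbb R_{\ge0}^X$ with $\|c_t\|_\infty\le\epsilon$ for all $t$, the algorithm with parameter $\kappa$ satisfies $$\mathsf{serv}\le\mathsf{cost}^*+\beta,\qquad \mathsf{move}\le C\,L\,(\Delta_0+\log|\mathcal P|)\,\mathsf{cost}^*+\beta,\qquad \mathsf{move}_X\le C\,L\,(\Delta_0+\log|\mathcal P|)\,\mathsf{cost}^*+\beta .$$ That is, it is $1$-competitive for service costs and $O(L(\Delta_0+\log|\mathcal P|))$-competitive for movement costs. -/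

import Mathlib

open scoped ENNReal

noncomputable section

/-- A marked DAG `(D, ω, θ)` over the finite set `X ⊆ V`: a finite directed acyclic graph on the
vertex set `V` with a single source `root`, whose set of sinks is `X`, with positive arc lengths `ω`
that decrease along paths, and with positive `θ` that sum to one over the arcs leaving any
vertex that is not a sink. Only the values of `ω` and `θ` on arcs are meaningful. -/
structure MarkedDAG {V : Type*} [Fintype V] (X : Finset V) where
  arc : V → V → Prop
  root : V
  ω : V → V → ℝ
  θ : V → V → ℝ
  acyclic : ∀ v, ¬ Relation.TransGen arc v v
  source_iff : ∀ v, (∀ u, ¬ arc u v) ↔ v = root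
  sink_iff : ∀ u, (∀ v, ¬ arc u v) ↔ u ∈ X
  ω_pos : ∀ u v, arc u v → 0 < ω u v
  ω_lt : ∀ u v w, arc u v → arc v w → ω v w < ω u v
  θ_pos : ∀ u v, arc u v → 0 < θ u v
  θ_sum : ∀ u, u ∉ X → (open Classical in ∑ v with arc u v, θ u v) = 1

/-- The `L¹`-transportation cost between `μ` and `ν` for the ground distance `d`: the infimum of
`∑ π(a,b) d(a,b)` over all couplings `π` of `μ` and `ν`. -/
def transportCost {α : Type*} [Fintype α] (d : α → α → ℝ) (μ ν : α → ℝ) : ℝ :=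
  sInf {s : ℝ | ∃ π : α → α → ℝ, (∀ a b, 0 ≤ π a b) ∧ (∀ a, ∑ b, π a b = μ a) ∧
    (∀ b, ∑ a, π a b = ν b) ∧ s = ∑ a, ∑ b, π a b * d a b}

/-- The cost of the offline optimum for the costs `c 0, c 1, …` (the cost `c t` arrives at time
`t + 1`) and the initial state `ρ₀`: the infimum of service plus movement cost over all sequences
of states that start at `ρ₀`. -/
def offlineCost {X : Type*} [MetricSpace X] (ρ₀ : X) (c : ℕ → X → ℝ) : ℝ≥0∞ :=
  ⨅ (ρ : ℕ → X) (_ : ρ 0 = ρ₀), ∑' t, ENNReal.ofReal (c t (ρ (t + 1)) + dist (ρ t) (ρ (t + 1)))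

namespace MarkedDAG

variable {V : Type*} [Fintype V] {X : Finset V} (D : MarkedDAG X)

open Classical in
/-- The heads of the arcs that leave `u`. -/
def children (u : V) : Finset V := {v | D.arc u v}

open Classical in
/-- The tails of the arcs that enter `v`. -/
def parents (v : V) : Finset V := {u | D.arc u v}

theorem mem_children {u v : V} : v ∈ D.children u ↔ D.arc u v := by
  simp [children]

theorem mem_parents {u v : V} : u ∈ D.parents v ↔ D.arc u v := by
  simp [parents]

theorem children_nonempty {u : V} (hu : u ∉ X) : (D.children u).Nonempty := by
  by_contra h
  apply hu
  rw [← D.sink_iff]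
  intro v hv
  exact h ⟨v, D.mem_children.2 hv⟩

theorem wf_arc : WellFounded D.arc := by
  have : Std.Irrefl (Relation.TransGen D.arc) := ⟨D.acyclic⟩
  exact Subrelation.wf (fun h => Relation.TransGen.single h)
    (Finite.wellFounded_of_trans_of_irrefl (Relation.TransGen D.arc))

theorem wf_arc_swap : WellFounded (fun v u => D.arc u v) := by
  have : Std.Irrefl (Function.swap (Relation.TransGen D.arc)) := ⟨D.acyclic⟩
  have : IsTrans V (Function.swap (Relation.TransGen D.arc)) := ⟨fun _ _ _ h k => k.trans h⟩
  exact Subrelation.wf (r := Function.swap (Relation.TransGen D.arc))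
    (fun h => Relation.TransGen.single h) (Finite.wellFounded_of_trans_of_irrefl _)

/-! ### Paths -/

/-- The directed paths from `u` to a sink, as lists of vertices (the list `[u]` if `u` is a sink). -/
def PathFrom (u : V) : Type _ :=
  {l : List V // l.IsChain D.arc ∧ l.head? = some u ∧ ∃ x ∈ X, l.getLast? = some x}

/-- The paths from the root to the sinks. -/
abbrev RootPath : Type _ := D.PathFrom D.root

theorem nodup_of_isChain {l : List V} (h : l.IsChain D.arc) : l.Nodup := by
  have h1 : l.IsChain (Relation.TransGen D.arc) :=
    h.imp (fun _ _ => Relation.TransGen.single)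
  refine (List.isChain_iff_pairwise.1 h1).imp ?_
  rintro a b hab rfl
  exact D.acyclic _ hab

instance (u : V) : Finite (D.PathFrom u) := by
  classical
  exact Finite.of_injective
    (fun γ : D.PathFrom u => (⟨γ.1, D.nodup_of_isChain γ.2.1⟩ : {l : List V // l.Nodup}))
    (fun a b h => Subtype.ext (Subtype.mk.inj h))

instance (u : V) : Fintype (D.PathFrom u) := Fintype.ofFinite _

/-- The final vertex of a path to a sink. -/
def endpoint {u : V} (γ : D.PathFrom u) : X :=
  ⟨γ.2.2.2.choose, γ.2.2.2.choose_spec.1⟩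

theorem getLast?_eq_endpoint {u : V} (γ : D.PathFrom u) :
    γ.1.getLast? = some (D.endpoint γ : V) := γ.2.2.2.choose_spec.2

/-- The number of paths from `u` to a sink. -/
def σ (u : V) : ℕ := Fintype.card (D.PathFrom u)

/-- The combinatorial depth: the maximum number of arcs of a path from the root to a sink. -/
def depth : ℕ := Finset.univ.sup (fun γ : D.RootPath => γ.1.length - 1)

/-- `∏ f u v` over the arcs `uv` of the path with the given list of vertices. -/
def arcProd (f : V → V → ℝ) : List V → ℝ
  | u :: v :: l => f u v * arcProd f (v :: l)
  | _ => 1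

open Classical in
/-- For two lists of vertices with the same first vertex: the larger of the two arc lengths at the
first vertex at which they diverge, and `0` if they do not diverge. -/
def divergence (ω : V → V → ℝ) : List V → List V → ℝ
  | u₁ :: v₁ :: l₁, u₂ :: v₂ :: l₂ =>
      if v₁ = v₂ then divergence ω (v₁ :: l₁) (v₂ :: l₂) else max (ω u₁ v₁) (ω u₂ v₂)
  | _, _ => 0

/-- The ultrametric on the paths from the root to the sinks. -/
def pathDist (γ₁ γ₂ : D.RootPath) : ℝ := divergence D.ω γ₁.1 γ₂.1

/-! ### Flows -/

/-- `F_u` for a vertex `u` that is not a sink. -/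
def outflow (F : V → V → ℝ) (u : V) : ℝ := ∑ v ∈ D.children u, F u v

/-- The flow entering the vertex `v`. -/
def inflow (F : V → V → ℝ) (v : V) : ℝ := ∑ u ∈ D.parents v, F u v

/-- Unit flows, as vectors in `ℝ^{V × V}` that vanish off the arcs. -/
structure IsUnitFlow (F : V → V → ℝ) : Prop where
  nonneg : ∀ u v, 0 ≤ F u v
  eq_zero : ∀ u v, ¬ D.arc u v → F u v = 0
  conservation : ∀ u, u ∉ X → u ≠ D.root → D.outflow F u = D.inflow F u
  unit : D.outflow F D.root = 1

/-- The probability distribution on the paths from the root to the sinks given by a unit flow `F`: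
the path that at each vertex `u` continues along the arc `uv` with probability `F_uv / F_u`.
(A path through a vertex `u` with `F_u = 0` has an earlier arc without flow, so probability `0`.) -/
def pathMeasure (F : V → V → ℝ) (γ : D.RootPath) : ℝ :=
  arcProd (fun u v => F u v / D.outflow F u) γ.1

/-- The transportation cost between unit flows with respect to the ultrametric on paths. -/
def flowW (F F' : V → V → ℝ) : ℝ :=
  transportCost D.pathDist (D.pathMeasure F) (D.pathMeasure F')

/-! ### Compatibility with a metric -/

def IsGeometric (τ : ℝ) : Prop :=
  ∀ u v w, D.arc u v → D.arc v w → τ * D.ω v w ≤ D.ω u v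

def IsExpanding [MetricSpace X] (ε : ℝ) : Prop :=
  ∀ γ₁ γ₂ : D.RootPath, ε * dist (D.endpoint γ₁) (D.endpoint γ₂) ≤ D.pathDist γ₁ γ₂

def IsLipschitz [MetricSpace X] (L : ℝ) : Prop :=
  ∀ (m : ℕ) (x : Fin (m + 1) → X), ∃ F : Fin (m + 1) → V → V → ℝ,
    (∀ i, D.IsUnitFlow (F i) ∧ D.inflow (F i) (x i) = 1) ∧
    ∑ i : Fin m, D.flowW (F i.castSucc) (F i.succ) ≤
      L * ∑ i : Fin m, dist (x i.castSucc) (x i.succ)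

/-! ### The discrete-time algorithm -/

def η (u v : V) : ℝ := 1 + Real.log (1 / D.θ u v)

def δ (u v : V) : ℝ := D.θ u v / D.η u v

/-- The probability simplex on the arcs that leave `u`. -/
def localSimplex (u : V) : Set (V → ℝ) :=
  {p | (∀ v, 0 ≤ p v) ∧ (∀ v, ¬ D.arc u v → p v = 0) ∧ ∑ v ∈ D.children u, p v = 1}

/-- The states of the algorithm: a point of the simplex for every vertex that is not a sink. -/
def states : Set (V → V → ℝ) :=
  {q | (∀ u, u ∉ X → q u ∈ D.localSimplex u) ∧ ∀ u ∈ X, q u = 0}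

/-- The Bregman divergence of the local entropy at `u`. -/
def localDiv (κ : ℝ) (u : V) (p p' : V → ℝ) : ℝ :=
  (1 / κ) * ∑ v ∈ D.children u, D.ω u v / D.η u v *
    ((p v + D.δ u v) * Real.log ((p v + D.δ u v) / (p' v + D.δ u v)) + p' v - p v)

/-- `p` minimises the divergence from `q` plus the linear cost `⟨p, ĉ⟩` over the simplex at `u`. -/
def IsLocalArgmin (κ : ℝ) (u : V) (q ĉ p : V → ℝ) : Prop :=
  p ∈ D.localSimplex u ∧ ∀ p' ∈ D.localSimplex u,
    D.localDiv κ u p q + ∑ v ∈ D.children u, p v * ĉ v ≤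
      D.localDiv κ u p' q + ∑ v ∈ D.children u, p' v * ĉ v

/-- The minimiser (unique by `existsUnique_isLocalArgmin`). -/
def localArgmin (κ : ℝ) (u : V) (q ĉ : V → ℝ) : V → ℝ :=
  Classical.epsilon (D.IsLocalArgmin κ u q ĉ)

open Classical in
/-- The costs `ĉ_u` of the vertices, given the costs `c` of the sinks, computed from the sinks
upwards. -/
def hatCost (κ : ℝ) (q : V → V → ℝ) (c : X → ℝ) : V → ℝ :=
  D.wf_arc_swap.fix fun u ih =>
    if h : u ∈ X then c ⟨u, h⟩
    else
      let ĉ : V → ℝ := fun v => if hv : D.arc u v then ih v hv else 0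
      ∑ v ∈ D.children u, D.localArgmin κ u (q u) ĉ v * ĉ v

open Classical in
/-- One step `𝒜(q, c)` of the algorithm. -/
def step (κ : ℝ) (q : V → V → ℝ) (c : X → ℝ) (u : V) : V → ℝ :=
  if u ∈ X then 0 else D.localArgmin κ u (q u) (D.hatCost κ q c)

/-- The trajectory `p_0, p_1, …` of the algorithm; the cost `c t` arrives at time `t + 1`. -/
def traj (κ : ℝ) (p₀ : V → V → ℝ) (c : ℕ → X → ℝ) : ℕ → V → V → ℝ
  | 0 => p₀
  | t + 1 => D.step κ (traj κ p₀ c t) (c t)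

open Classical in
/-- The flow `F_v` through `v` when `q` gives the transition probabilities. -/
def nodeFlow (q : V → V → ℝ) : V → ℝ :=
  D.wf_arc.fix fun v ih =>
    if v = D.root then 1 else ∑ u, if h : D.arc u v then ih u h * q u v else 0

/-- The map `Λ`: the unit flow with `F_uv = F_u q_uv` on all arcs. -/
def Λ (q : V → V → ℝ) (u v : V) : ℝ := D.nodeFlow q u * q u v

/-- The distribution on the sinks that the algorithm plays in the state `q`. -/
def played (q : V → V → ℝ) (x : X) : ℝ := D.inflow (D.Λ q) x

/-- The total service cost. -/
def serviceCost (κ : ℝ) (p₀ : V → V → ℝ) (c : ℕ → X → ℝ) : ℝ≥0∞ :=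
  ∑' t, ENNReal.ofReal (∑ x, c t x * D.played (D.traj κ p₀ c (t + 1)) x)

/-- The total movement cost, measured by transportation of the flows over the ultrametric. -/
def movementCost (κ : ℝ) (p₀ : V → V → ℝ) (c : ℕ → X → ℝ) : ℝ≥0∞ :=
  ∑' t, ENNReal.ofReal
    (D.flowW (D.Λ (D.traj κ p₀ c t)) (D.Λ (D.traj κ p₀ c (t + 1))))

/-- The total movement cost, measured by transportation in the metric space `X` of the distributions
that are played. -/
def metricMovementCost [MetricSpace X] (κ : ℝ) (p₀ : V → V → ℝ) (c : ℕ → X → ℝ) : ℝ≥0∞ :=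
  ∑' t, ENNReal.ofReal
    (transportCost (dist : X → X → ℝ) (D.played (D.traj κ p₀ c t))
      (D.played (D.traj κ p₀ c (t + 1))))

/-! ### The definitions above are as described -/

theorem one_le_η {u v : V} (h : D.arc u v) : 1 ≤ D.η u v := by
  classical
  have hu : u ∉ X := fun hu => (D.sink_iff u).2 hu v h
  have h1 : D.θ u v ≤ 1 := by
    rw [← D.θ_sum u hu]
    exact Finset.single_le_sum (f := fun v => D.θ u v)
      (fun w hw => (D.θ_pos u w (by simpa using hw)).le) (by simpa using h)
  have := Real.log_nonneg (one_le_one_div (D.θ_pos u v h) h1)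
  unfold η
  linarith

theorem δ_pos {u v : V} (h : D.arc u v) : 0 < D.δ u v :=
  div_pos (D.θ_pos u v h) (by linarith [D.one_le_η h])

theorem hatCost_sink (κ : ℝ) (q : V → V → ℝ) (c : X → ℝ) (x : X) :
    D.hatCost κ q c x = c x := by
  rw [hatCost, WellFounded.fix_eq]
  simp

theorem localArgmin_congr (κ : ℝ) (u : V) (q : V → ℝ) {ĉ ĉ' : V → ℝ}
    (h : ∀ v, D.arc u v → ĉ v = ĉ' v) : D.localArgmin κ u q ĉ = D.localArgmin κ u q ĉ' := by
  have (p : V → ℝ) : ∑ v ∈ D.children u, p v * ĉ v = ∑ v ∈ D.children u, p v * ĉ' v :=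
    Finset.sum_congr rfl fun v hv => by rw [h v (D.mem_children.1 hv)]
  have h2 : D.IsLocalArgmin κ u q ĉ = D.IsLocalArgmin κ u q ĉ' := by
    funext p
    simp only [IsLocalArgmin, this]
  rw [localArgmin, localArgmin, h2]

theorem hatCost_eq (κ : ℝ) (q : V → V → ℝ) (c : X → ℝ) {u : V} (hu : u ∉ X) :
    D.hatCost κ q c u = ∑ v ∈ D.children u, D.step κ q c u v * D.hatCost κ q c v := by
  classical
  rw [hatCost, WellFounded.fix_eq]
  simp only [hu, dite_false]
  refine Finset.sum_congr rfl fun v hv => ?_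
  rw [dif_pos (D.mem_children.1 hv), step, if_neg hu]
  congr 1
  refine congrFun (D.localArgmin_congr κ u (q u) fun w hw => ?_) v
  rw [dif_pos hw]
  rfl

theorem nodeFlow_root (q : V → V → ℝ) : D.nodeFlow q D.root = 1 := by
  rw [nodeFlow, WellFounded.fix_eq]
  simp

theorem nodeFlow_eq (q : V → V → ℝ) {v : V} (hv : v ≠ D.root) :
    D.nodeFlow q v = D.inflow (D.Λ q) v := by
  classical
  rw [nodeFlow, WellFounded.fix_eq]
  simp only [hv, if_false, inflow, parents, Finset.sum_filter, Λ]
  refine Finset.sum_congr rfl fun u _ => ?_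
  by_cases h : D.arc u v
  · rw [dif_pos h, if_pos h]; rfl
  · rw [dif_neg h, if_neg h]

theorem localSimplex_isCompact (u : V) : IsCompact (D.localSimplex u) := by
  refine IsCompact.of_isClosed_subset (isCompact_univ_pi (fun _ : V => isCompact_Icc (a := (0 : ℝ)) (b := 1))) ?_ ?_
  · unfold localSimplex
    simp only [Set.ofPred_and, Set.ofPred_forall]
    refine IsClosed.inter (isClosed_iInter fun v => isClosed_le continuous_const (by fun_prop))
      (IsClosed.inter (isClosed_iInter fun v => isClosed_iInter fun _ =>
        isClosed_eq (by fun_prop) continuous_const) (isClosed_eq (by fun_prop) continuous_const))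
  · rintro p ⟨h0, h1, h2⟩ v -
    refine ⟨h0 v, ?_⟩
    by_cases hv : D.arc u v
    · rw [← h2]
      exact Finset.single_le_sum (f := p) (fun w _ => h0 w) (D.mem_children.2 hv)
    · rw [h1 v hv]; exact zero_le_one

theorem localSimplex_nonempty {u : V} (hu : u ∉ X) : (D.localSimplex u).Nonempty := by
  classical
  obtain ⟨w, hw⟩ := D.children_nonempty hu
  refine ⟨Pi.single w 1, fun v => ?_, fun v hv => ?_, ?_⟩
  · by_cases h : v = w
    · subst h; simp
    · simp [h]
  · have : v ≠ w := fun h => hv (h ▸ D.mem_children.1 hw)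
    simp [this]
  · simp [Pi.single_apply, hw]

theorem existsUnique_isLocalArgmin {κ : ℝ} (hκ : 0 < κ) {u : V} (hu : u ∉ X) {q : V → ℝ}
    (hq : ∀ v, 0 ≤ q v) (ĉ : V → ℝ) : ∃! p, D.IsLocalArgmin κ u q ĉ p := by
  have hpos {p : V → ℝ} (hp : ∀ v, 0 ≤ p v) {v : V} (hv : v ∈ D.children u) :
      0 < p v + D.δ u v := add_pos_of_nonneg_of_pos (hp v) (D.δ_pos (D.mem_children.1 hv))
  have hk {v : V} (hv : v ∈ D.children u) : 0 < D.ω u v / D.η u v :=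
    div_pos (D.ω_pos u v (D.mem_children.1 hv)) (by linarith [D.one_le_η (D.mem_children.1 hv)])
  have hcont : ContinuousOn (fun p => D.localDiv κ u p q + ∑ v ∈ D.children u, p v * ĉ v)
      (D.localSimplex u) := by
    unfold localDiv
    refine ContinuousOn.add (continuousOn_const.mul (continuousOn_finsetSum _ fun v hv => ?_))
      (by fun_prop)
    refine continuousOn_const.mul (ContinuousOn.sub (ContinuousOn.add (ContinuousOn.mul
      (by fun_prop) (ContinuousOn.log (by fun_prop) fun p hp => ?_)) continuousOn_const)
      (by fun_prop))
    exact (div_pos (hpos hp.1 hv) (hpos hq hv)).ne'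
  obtain ⟨p, hp, hmin⟩ := (D.localSimplex_isCompact u).exists_isMinOn
    (D.localSimplex_nonempty hu) hcont
  have hpm : D.IsLocalArgmin κ u q ĉ p := ⟨hp, fun p' hp' => hmin hp'⟩
  refine ⟨p, hpm, fun p' hp' => ?_⟩
  by_contra hne
  have hp1 := hp'.1
  obtain ⟨w, hw⟩ : ∃ w, p' w ≠ p w := by
    by_contra h
    push Not at h
    exact hne (funext h)
  have hwc : w ∈ D.children u := by
    by_contra h
    rw [D.mem_children] at h
    exact hw (by rw [hp1.2.1 w h, hp.2.1 w h])
  let m : V → ℝ := fun v => (1 / 2) * p v + (1 / 2) * p' v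
  have hm : m ∈ D.localSimplex u := by
    refine ⟨fun v => ?_, fun v hv => ?_, ?_⟩
    · have := hp.1 v
      have := hp1.1 v
      simp only [m]
      positivity
    · simp [m, hp.2.1 v hv, hp1.2.1 v hv]
    · simp only [m, Finset.sum_add_distrib, ← Finset.mul_sum, hp.2.2, hp1.2.2]
      norm_num
  have hlog {x b : ℝ} (hx : 0 < x) (hb : 0 < b) : x * Real.log (x / b) =
      x * Real.log x - x * Real.log b := by
    rw [Real.log_div hx.ne' hb.ne']; ring
  let g : (V → ℝ) → V → ℝ := fun r v => D.ω u v / D.η u v *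
    ((r v + D.δ u v) * Real.log ((r v + D.δ u v) / (q v + D.δ u v)) + q v - r v)
  have hle : ∀ v ∈ D.children u, g m v ≤ (1 / 2) * g p v + (1 / 2) * g p' v := by
    intro v hv
    have h1 := hpos hp.1 hv
    have h2 := hpos hp1.1 hv
    have h3 := (Real.convexOn_mul_log).2 (Set.mem_Ici.2 h1.le) (Set.mem_Ici.2 h2.le)
      (show (0 : ℝ) ≤ 1 / 2 by norm_num) (show (0 : ℝ) ≤ 1 / 2 by norm_num) (by norm_num)
    simp only [smul_eq_mul] at h3
    have e : (1 / 2) * (p v + D.δ u v) + (1 / 2) * (p' v + D.δ u v) = m v + D.δ u v := by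
      simp only [m]; ring
    rw [e] at h3
    simp only [g]
    rw [hlog h1 (hpos hq hv), hlog h2 (hpos hq hv), hlog (hpos hm.1 hv) (hpos hq hv)]
    have := mul_le_mul_of_nonneg_left h3 (hk hv).le
    simp only [m] at this ⊢
    linarith
  have hlt : g m w < (1 / 2) * g p w + (1 / 2) * g p' w := by
    have h1 := hpos hp.1 hwc
    have h2 := hpos hp1.1 hwc
    have h3 := (Real.strictConvexOn_mul_log).2 (Set.mem_Ici.2 h1.le) (Set.mem_Ici.2 h2.le)
      (fun h => hw (by linarith)) (show (0 : ℝ) < 1 / 2 by norm_num)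
      (show (0 : ℝ) < 1 / 2 by norm_num) (by norm_num)
    simp only [smul_eq_mul] at h3
    have e : (1 / 2) * (p w + D.δ u w) + (1 / 2) * (p' w + D.δ u w) = m w + D.δ u w := by
      simp only [m]; ring
    rw [e] at h3
    simp only [g]
    rw [hlog h1 (hpos hq hwc), hlog h2 (hpos hq hwc), hlog (hpos hm.1 hwc) (hpos hq hwc)]
    have := mul_lt_mul_of_pos_left h3 (hk hwc)
    simp only [m] at this ⊢
    linarith
  have hsum := Finset.sum_lt_sum hle ⟨w, hwc, hlt⟩
  rw [Finset.sum_add_distrib, ← Finset.mul_sum, ← Finset.mul_sum] at hsum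
  have hlin : ∑ v ∈ D.children u, m v * ĉ v =
      (1 / 2) * ∑ v ∈ D.children u, p v * ĉ v + (1 / 2) * ∑ v ∈ D.children u, p' v * ĉ v := by
    simp only [m, Finset.mul_sum, ← Finset.sum_add_distrib]
    exact Finset.sum_congr rfl fun v _ => by ring
  have a1 := hpm.2 m hm
  have a2 := hp'.2 m hm
  have hlt2 := mul_lt_mul_of_pos_left hsum (one_div_pos.2 hκ)
  have d (r : V → ℝ) : D.localDiv κ u r q = (1 / κ) * ∑ v ∈ D.children u, g r v := rfl
  rw [d, d] at a1 a2
  linarith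

theorem localArgmin_spec {κ : ℝ} (hκ : 0 < κ) {u : V} (hu : u ∉ X) {q : V → ℝ}
    (hq : ∀ v, 0 ≤ q v) (ĉ : V → ℝ) : D.IsLocalArgmin κ u q ĉ (D.localArgmin κ u q ĉ) :=
  Classical.epsilon_spec (D.existsUnique_isLocalArgmin hκ hu hq ĉ).exists

theorem states_nonneg {q : V → V → ℝ} (hq : q ∈ D.states) (u v : V) : 0 ≤ q u v := by
  by_cases hu : u ∈ X
  · rw [hq.2 u hu]; exact le_rfl
  · exact (hq.1 u hu).1 v

theorem step_mem_states {κ : ℝ} (hκ : 0 < κ) {q : V → V → ℝ} (hq : q ∈ D.states) (c : X → ℝ) :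
    D.step κ q c ∈ D.states := by
  refine ⟨fun u hu => ?_, fun u hu => by rw [step, if_pos hu]⟩
  rw [step, if_neg hu]
  exact (D.localArgmin_spec hκ hu (D.states_nonneg hq u) _).1

theorem Λ_isUnitFlow (hr : D.root ∉ X) {q : V → V → ℝ} (hq : q ∈ D.states) :
    D.IsUnitFlow (D.Λ q) := by
  have hn : ∀ v, 0 ≤ D.nodeFlow q v := by
    intro v
    induction v using D.wf_arc.induction with
    | _ v ih =>
      by_cases hv : v = D.root
      · rw [hv, D.nodeFlow_root]; exact zero_le_one
      · rw [D.nodeFlow_eq q hv]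
        exact Finset.sum_nonneg fun u hu =>
          mul_nonneg (ih u (D.mem_parents.1 hu)) (D.states_nonneg hq u v)
  have ho {u : V} (hu : u ∉ X) : D.outflow (D.Λ q) u = D.nodeFlow q u := by
    simp only [outflow, Λ, ← Finset.mul_sum]
    rw [(hq.1 u hu).2.2, mul_one]
  refine ⟨fun u v => mul_nonneg (hn u) (D.states_nonneg hq u v), fun u v h => ?_,
    fun u hu hur => by rw [ho hu, D.nodeFlow_eq q hur], by rw [ho hr, D.nodeFlow_root]⟩
  by_cases hu : u ∈ X
  · simp [Λ, hq.2 u hu]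
  · simp [Λ, (hq.1 u hu).2.1 v h]

end MarkedDAG

end

/-!
The algorithm is mirror descent at every vertex, and both bounds come from potential functions.

*Service.* At a vertex, mirror descent moves closer to any point of the simplex by at least the
excess of its own cost over the cost of that point (`IsLocalArgmin.localDiv_sub_le`). Weighted by
the flow of a comparator `z` these inequalities telescope along the graph, so the global divergence
of the state from `z` falls by the excess of the service cost over that of `z`
(`globalDiv_step_sub_le`). When the comparator moves, the divergence grows by at most `3 / κ` times
the length-weighted change of its flow (`globalDiv_sub_le`), which is at most `8 / κ` times its
transportation cost (`flowDiff_le_flowW`). The Lipschitz property provides comparators that follow a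
given offline sequence at `L` times its movement cost, so for `κ = 8 * L` the total is at most the
offline cost (`sum_service_le`).

*Movement.* By the Karush-Kuhn-Tucker conditions the mass that leaves an arc `uv` is at most
`κ / ω_uv * (η_uv * q_uv + θ_uv)` times a reduced cost `s_uv` of the arc (`ω_mul_max_sub_le`). In
the sum over the graph, weighted with the flow, the part with `η` is at most the service cost
times the height plus `log` of the number of paths, since `θ_uv = σ v / σ u` makes `η` telescope
along paths (`one_add_η_add_rank_le`). The part with `θ` would be the cost of playing `θ` instead of
the state; it is the service cost plus the change of the divergence from `θ`
(`sum_mul_multiplier_eq`). That divergence serves as a potential: the change of its weights costs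
at most four fifths of the movement, because arc lengths fall by a factor of four
(`sum_nodeFlow_mul_prior_le`). All remaining errors are products of the small service costs of one
step and the movement, and are absorbed for small `ε` (`moveDown_step_le`). The mass that enters
arcs is controlled by the mass that leaves arcs, through the mean length of the random path
(`moveUp_le`). A coupling of random paths bounds the two transportation costs by this movement
(`sum_coupling_mul_pathDist_le`).

The passage between different flow weights is always the performance difference lemma for Markov
chains (`sum_nodeFlow_value`).
-/

noncomputable section

namespace MarkedDAG

variable {V : Type*} [Fintype V] {X : Finset V} (D : MarkedDAG X)

/-! ### Flows and value functions -/

theorem not_mem_of_arc {u v : V} (h : D.arc u v) : u ∉ X :=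
  fun hu => (D.sink_iff u).2 hu v h

theorem children_eq_empty {u : V} (hu : u ∈ X) : D.children u = ∅ :=
  Finset.eq_empty_of_forall_notMem fun _ hv => D.not_mem_of_arc (D.mem_children.1 hv) hu

theorem parents_root : D.parents D.root = ∅ :=
  Finset.eq_empty_of_forall_notMem fun u hu =>
    (D.source_iff D.root).2 rfl u (D.mem_parents.1 hu)

/-- Interchange of the two ways to sum over the arcs. -/
theorem sum_children_comm (f : V → V → ℝ) :
    ∑ u, ∑ v ∈ D.children u, f u v = ∑ v, ∑ u ∈ D.parents v, f u v :=
  Finset.sum_comm' (by simp [D.mem_children, D.mem_parents])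

theorem nodeFlow_nonneg {q : V → V → ℝ} (hq : q ∈ D.states) (v : V) : 0 ≤ D.nodeFlow q v := by
  induction v using D.wf_arc.induction with
  | _ v ih =>
    by_cases hv : v = D.root
    · rw [hv, D.nodeFlow_root]; exact zero_le_one
    · rw [D.nodeFlow_eq q hv]
      exact Finset.sum_nonneg fun u hu =>
        mul_nonneg (ih u (D.mem_parents.1 hu)) (D.states_nonneg hq u v)

theorem outflow_Λ {q : V → V → ℝ} (hq : q ∈ D.states) {u : V} (hu : u ∉ X) :
    D.outflow (D.Λ q) u = D.nodeFlow q u := by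
  simp only [outflow, Λ, ← Finset.mul_sum]
  rw [(hq.1 u hu).2.2, mul_one]

/-- Flow conservation, tested against a function `H` on the vertices. -/
theorem sum_nodeFlow_mul (q : V → V → ℝ) (H : V → ℝ) :
    ∑ v, D.nodeFlow q v * H v =
      H D.root + ∑ u, D.nodeFlow q u * ∑ v ∈ D.children u, q u v * H v := by
  classical
  have h1 (v : V) : D.nodeFlow q v * H v =
      (if v = D.root then H v else 0) + ∑ u ∈ D.parents v, D.nodeFlow q u * (q u v * H v) := by
    by_cases hv : v = D.root
    · subst hv
      simp [D.parents_root, D.nodeFlow_root]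
    · rw [D.nodeFlow_eq q hv, if_neg hv, zero_add, inflow, Finset.sum_mul]
      exact Finset.sum_congr rfl fun u _ => by rw [Λ, mul_assoc]
  simp only [h1, Finset.sum_add_distrib, Finset.mul_sum, Finset.sum_ite_eq', Finset.mem_univ,
    if_true]
  rw [D.sum_children_comm]

/-- The expected total reward `g` that the Markov chain with transitions `p` collects from each
vertex on. -/
theorem exists_value (p : V → V → ℝ) (g : V → ℝ) :
    ∃ H : V → ℝ, ∀ u, H u = g u + ∑ v ∈ D.children u, p u v * H v := by
  classical
  refine ⟨D.wf_arc_swap.fix fun u ih => g u + ∑ v ∈ D.children u,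
    p u v * (if hv : D.arc u v then ih v hv else 0), fun u => ?_⟩
  rw [WellFounded.fix_eq]
  congr 1
  refine Finset.sum_congr rfl fun v hv => ?_
  rw [dif_pos (D.mem_children.1 hv)]

/-- The performance difference lemma: the expected reward of the chain `q`, in terms of the value
function of the chain `p`. -/
theorem sum_nodeFlow_value {p : V → V → ℝ} {g H : V → ℝ}
    (hH : ∀ u, H u = g u + ∑ v ∈ D.children u, p u v * H v) (q : V → V → ℝ) :
    ∑ u, D.nodeFlow q u * g u =
      H D.root + ∑ u, D.nodeFlow q u * ∑ v ∈ D.children u, (q u v - p u v) * H v := by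
  have h1 := D.sum_nodeFlow_mul q H
  have h2 : ∑ u, D.nodeFlow q u * H u = ∑ u, D.nodeFlow q u * g u +
      ∑ u, D.nodeFlow q u * ∑ v ∈ D.children u, p u v * H v := by
    rw [← Finset.sum_add_distrib]
    exact Finset.sum_congr rfl fun u _ => by rw [← mul_add, ← hH]
  have h3 : ∑ u, D.nodeFlow q u * ∑ v ∈ D.children u, (q u v - p u v) * H v =
      ∑ u, D.nodeFlow q u * ∑ v ∈ D.children u, q u v * H v -
      ∑ u, D.nodeFlow q u * ∑ v ∈ D.children u, p u v * H v := by
    rw [← Finset.sum_sub_distrib]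
    refine Finset.sum_congr rfl fun u _ => ?_
    rw [← mul_sub, ← Finset.sum_sub_distrib]
    simp only [sub_mul]
  linarith

theorem sum_nodeFlow_value_self {p : V → V → ℝ} {g H : V → ℝ}
    (hH : ∀ u, H u = g u + ∑ v ∈ D.children u, p u v * H v) :
    ∑ u, D.nodeFlow p u * g u = H D.root := by
  simpa using D.sum_nodeFlow_value hH p

/-- Comparison of a value function with a supersolution `B`. -/
theorem value_le {p : V → V → ℝ} (hp : p ∈ D.states) {g H B : V → ℝ}
    (hH : ∀ u, H u = g u + ∑ v ∈ D.children u, p u v * H v)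
    (hB : ∀ u, g u + ∑ v ∈ D.children u, p u v * B v ≤ B u) (u : V) : H u ≤ B u := by
  induction u using D.wf_arc_swap.induction with
  | _ u ih =>
    rw [hH]
    refine le_trans ?_ (hB u)
    gcongr with v hv
    · exact D.states_nonneg hp u v
    · exact ih v (D.mem_children.1 hv)

theorem value_nonneg {p : V → V → ℝ} (hp : p ∈ D.states) {g H : V → ℝ}
    (hH : ∀ u, H u = g u + ∑ v ∈ D.children u, p u v * H v)
    (hg : ∀ u, 0 ≤ g u) (u : V) : 0 ≤ H u := by
  induction u using D.wf_arc_swap.induction with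
  | _ u ih =>
    rw [hH]
    exact add_nonneg (hg u) (Finset.sum_nonneg fun v hv =>
      mul_nonneg (D.states_nonneg hp u v) (ih v (D.mem_children.1 hv)))

/-- A sum over the arcs that leave `u`, weighted by a state, is at most any nonnegative upper bound
of the summands. Sinks have no arcs, hence the hypothesis `0 ≤ B`. -/
theorem sum_state_mul_le {p : V → V → ℝ} (hp : p ∈ D.states) {u : V} {f : V → ℝ} {B : ℝ}
    (hB : 0 ≤ B) (hf : ∀ v, D.arc u v → f v ≤ B) : ∑ v ∈ D.children u, p u v * f v ≤ B := by
  by_cases hu : u ∈ X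
  · simpa [D.children_eq_empty hu] using hB
  · calc ∑ v ∈ D.children u, p u v * f v ≤ ∑ v ∈ D.children u, p u v * B :=
          Finset.sum_le_sum fun v hv => mul_le_mul_of_nonneg_left (hf v (D.mem_children.1 hv))
            (D.states_nonneg hp u v)
      _ = B := by rw [← Finset.sum_mul, (hp.1 u hu).2.2, one_mul]

/-! ### Geometric arc lengths -/

/-- `m u` bounds the lengths of the arcs that leave `u`, and is at most a quarter of the length of
every arc that enters `u`. In a geometric graph the maximal length of an outgoing arc (zero at the
sinks) has this property. -/
def IsScale (m : V → ℝ) : Prop :=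
  (∀ u, 0 ≤ m u) ∧ (∀ u v, D.arc u v → D.ω u v ≤ m u) ∧ ∀ u v, D.arc u v → 4 * m v ≤ D.ω u v

variable {D}

theorem IsGeometric.exists_isScale {τ : ℝ} (h4 : 4 ≤ τ) (h : D.IsGeometric τ) :
    ∃ m, D.IsScale m := by
  classical
  have hex (u : V) : ∃ a : ℝ, (a = 0 ∨ ∃ w, D.arc u w ∧ a = D.ω u w) ∧
      ∀ v, D.arc u v → D.ω u v ≤ a := by
    by_cases hu : (D.children u).Nonempty
    · obtain ⟨w, hw, hmax⟩ := Finset.exists_max_image _ (D.ω u) hu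
      exact ⟨D.ω u w, Or.inr ⟨w, D.mem_children.1 hw, rfl⟩,
        fun v hv => hmax v (D.mem_children.2 hv)⟩
    · exact ⟨0, Or.inl rfl, fun v hv => absurd ⟨v, D.mem_children.2 hv⟩ hu⟩
  choose m hm1 hm2 using hex
  refine ⟨m, fun u => ?_, fun u v => hm2 u v, fun u v huv => ?_⟩
  · rcases hm1 u with h0 | ⟨w, hw, h0⟩
    · exact h0.ge
    · rw [h0]; exact (D.ω_pos u w hw).le
  · rcases hm1 v with h0 | ⟨w, hw, h0⟩
    · rw [h0, mul_zero]; exact (D.ω_pos u v huv).le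
    · rw [h0]
      exact (mul_le_mul_of_nonneg_right h4 (D.ω_pos v w hw).le).trans (h u v w huv hw)

variable (D)

/-- Along a path the scale decays geometrically, so that a value function whose rewards are bounded
by a scale is bounded by the scale too. -/
theorem value_le_scale {m : V → ℝ} (hm : D.IsScale m) {p : V → V → ℝ} (hp : p ∈ D.states)
    {g H : V → ℝ} (hH : ∀ u, H u = g u + ∑ v ∈ D.children u, p u v * H v) {G : ℝ} (hG : 0 ≤ G)
    (hg : ∀ u, g u ≤ G * m u) (u : V) : H u ≤ 4 / 3 * G * m u := by
  refine D.value_le hp hH (B := fun u => 4 / 3 * G * m u) (fun u => ?_) u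
  have h1 : ∑ v ∈ D.children u, p u v * (4 / 3 * G * m v) ≤ 1 / 3 * G * m u := by
    refine D.sum_state_mul_le hp (by have := hm.1 u; positivity) fun v hv => ?_
    have h2 : 4 * m v ≤ m u := (hm.2.2 u v hv).trans (hm.2.1 u v hv)
    have := mul_le_mul_of_nonneg_left h2 hG
    linarith
  have := hg u
  linarith

/-- The total reward of a chain with rewards bounded by a scale. -/
theorem sum_nodeFlow_le_scale {m : V → ℝ} (hm : D.IsScale m) {p : V → V → ℝ} (hp : p ∈ D.states)
    {g : V → ℝ} {G : ℝ} (hG : 0 ≤ G) (hg : ∀ u, g u ≤ G * m u) :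
    ∑ u, D.nodeFlow p u * g u ≤ 4 / 3 * G * m D.root := by
  obtain ⟨H, hH⟩ := D.exists_value p g
  rw [D.sum_nodeFlow_value_self hH]
  exact D.value_le_scale hm hp hH hG hg _

/-- A bound on the correction term of `sum_nodeFlow_value`: a nonnegative value function `H` that is
at most `B` times the length of each incoming arc only charges the mass that leaves arcs. -/
theorem sum_sub_mul_value_le {q p : V → V → ℝ} (hq : q ∈ D.states) {H : V → ℝ} {B : ℝ}
    (h0 : ∀ u, 0 ≤ H u) (hB : ∀ u v, D.arc u v → H v ≤ B * D.ω u v) :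
    ∑ u, D.nodeFlow q u * ∑ v ∈ D.children u, (q u v - p u v) * H v ≤
      B * ∑ u, D.nodeFlow q u * ∑ v ∈ D.children u, D.ω u v * max (q u v - p u v) 0 := by
  rw [Finset.mul_sum]
  refine Finset.sum_le_sum fun u _ => ?_
  rw [mul_left_comm]
  refine mul_le_mul_of_nonneg_left ?_ (D.nodeFlow_nonneg hq u)
  rw [Finset.mul_sum]
  refine Finset.sum_le_sum fun v hv => ?_
  calc (q u v - p u v) * H v ≤ max (q u v - p u v) 0 * H v :=
        mul_le_mul_of_nonneg_right (le_max_left _ _) (h0 v)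
    _ ≤ max (q u v - p u v) 0 * (B * D.ω u v) :=
        mul_le_mul_of_nonneg_left (hB u v (D.mem_children.1 hv)) (le_max_right _ _)
    _ = B * (D.ω u v * max (q u v - p u v) 0) := by ring

/-! ### One step of mirror descent at a vertex -/

theorem mul_log_div_add_sub_nonneg {a b : ℝ} (ha : 0 < a) (hb : 0 < b) :
    0 ≤ a * Real.log (a / b) + b - a := by
  have h := Real.log_le_sub_one_of_pos (div_pos hb ha)
  rw [← inv_div a b, Real.log_inv] at h
  have h2 := mul_le_mul_of_nonneg_left h ha.le
  have h3 : a * ((a / b)⁻¹ - 1) = b - a := by field_simp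
  linarith

theorem mul_log_div_add_sub_le {a b : ℝ} (ha : 0 < a) (hb : 0 < b) :
    a * Real.log (a / b) + b - a ≤ (a - b) ^ 2 / b := by
  have h2 := mul_le_mul_of_nonneg_left (Real.log_le_sub_one_of_pos (div_pos ha hb)) ha.le
  have h3 : a * (a / b - 1) + b - a = (a - b) ^ 2 / b := by field_simp; ring
  linarith

theorem η_pos {u v : V} (h : D.arc u v) : 0 < D.η u v := zero_lt_one.trans_le (D.one_le_η h)

theorem weight_pos {u v : V} (h : D.arc u v) : 0 < D.ω u v / D.η u v :=
  div_pos (D.ω_pos u v h) (D.η_pos h)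

theorem localDiv_nonneg {κ : ℝ} (hκ : 0 < κ) (u : V) {p q : V → ℝ} (hp : ∀ v, 0 ≤ p v)
    (hq : ∀ v, 0 ≤ q v) : 0 ≤ D.localDiv κ u p q := by
  refine mul_nonneg (one_div_pos.2 hκ).le (Finset.sum_nonneg fun v hv => ?_)
  have hv := D.mem_children.1 hv
  refine mul_nonneg (D.weight_pos hv).le ?_
  have := mul_log_div_add_sub_nonneg (add_pos_of_nonneg_of_pos (hp v) (D.δ_pos hv))
    (add_pos_of_nonneg_of_pos (hq v) (D.δ_pos hv))
  linarith

theorem localDiv_self (κ : ℝ) (u : V) {p : V → ℝ} (hp : ∀ v, 0 ≤ p v) :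
    D.localDiv κ u p p = 0 := by
  unfold localDiv
  rw [Finset.sum_eq_zero, mul_zero]
  intro v hv
  rw [div_self (add_pos_of_nonneg_of_pos (hp v) (D.δ_pos (D.mem_children.1 hv))).ne']
  simp

/-- The gradient at `p` of the divergence `𝔻(· ‖ q)` at the vertex `u`. -/
def localGrad (κ : ℝ) (u : V) (p q : V → ℝ) (v : V) : ℝ :=
  1 / κ * (D.ω u v / D.η u v * Real.log ((p v + D.δ u v) / (q v + D.δ u v)))

/-- The three-point identity of Bregman divergences. -/
theorem localDiv_three_point (κ : ℝ) (u : V) {y p q : V → ℝ} (hy : ∀ v, 0 ≤ y v)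
    (hp : ∀ v, 0 ≤ p v) (hq : ∀ v, 0 ≤ q v) :
    D.localDiv κ u y q = D.localDiv κ u y p + D.localDiv κ u p q +
      ∑ v ∈ D.children u, D.localGrad κ u p q v * (y v - p v) := by
  unfold localDiv localGrad
  simp only [Finset.mul_sum, ← Finset.sum_add_distrib]
  refine Finset.sum_congr rfl fun v hv => ?_
  have hd := D.δ_pos (D.mem_children.1 hv)
  have h1 := (add_pos_of_nonneg_of_pos (hy v) hd).ne'
  have h2 := (add_pos_of_nonneg_of_pos (hp v) hd).ne'
  have h3 := (add_pos_of_nonneg_of_pos (hq v) hd).ne'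
  rw [Real.log_div h1 h3, Real.log_div h1 h2, Real.log_div h2 h3]
  ring

/-- The first-order optimality condition of the local minimisation problem. -/
theorem IsLocalArgmin.variational {κ : ℝ} (hκ : 0 < κ) {u : V} {q ĉ p : V → ℝ}
    (hq : ∀ v, 0 ≤ q v) (h : D.IsLocalArgmin κ u q ĉ p) {y : V → ℝ} (hy : y ∈ D.localSimplex u) :
    0 ≤ ∑ v ∈ D.children u, (D.localGrad κ u p q v + ĉ v) * (y v - p v) := by
  obtain ⟨hp, hmin⟩ := h
  set S := ∑ v ∈ D.children u, (D.localGrad κ u p q v + ĉ v) * (y v - p v) with hS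
  set K := 1 / κ * ∑ v ∈ D.children u, D.ω u v / D.η u v *
    ((y v - p v) ^ 2 / (p v + D.δ u v)) with hK
  -- Moving from `p` a fraction `t` of the way towards `y` changes the objective by at most
  -- `t * S + t ^ 2 * K`.
  have key (t : ℝ) (h0 : 0 < t) (h1 : t ≤ 1) : 0 ≤ S + t * K := by
    let z : V → ℝ := fun v => p v + t * (y v - p v)
    have hz0 (v : V) : 0 ≤ z v := by
      have := mul_nonneg h0.le (hy.1 v)
      have := mul_nonneg (sub_nonneg.2 h1) (hp.1 v)
      simp only [z]; linarith
    have hz : z ∈ D.localSimplex u := by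
      refine ⟨hz0, fun v hv => by simp [z, hp.2.1 v hv, hy.2.1 v hv], ?_⟩
      simp only [z, Finset.sum_add_distrib, ← Finset.mul_sum, Finset.sum_sub_distrib, hp.2.2,
        hy.2.2]
      ring
    have h2 := hmin z hz
    have h3 := D.localDiv_three_point κ u hz0 hp.1 hq
    have h4 : D.localDiv κ u z p ≤ t ^ 2 * K := by
      rw [hK, mul_left_comm]
      unfold localDiv
      refine mul_le_mul_of_nonneg_left ?_ (one_div_pos.2 hκ).le
      rw [Finset.mul_sum]
      refine Finset.sum_le_sum fun v hv => ?_
      have hv := D.mem_children.1 hv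
      rw [mul_left_comm]
      refine mul_le_mul_of_nonneg_left ?_ (D.weight_pos hv).le
      have h5 := mul_log_div_add_sub_le (add_pos_of_nonneg_of_pos (hz0 v) (D.δ_pos hv))
        (add_pos_of_nonneg_of_pos (hp.1 v) (D.δ_pos hv))
      have h6 : (z v + D.δ u v - (p v + D.δ u v)) ^ 2 / (p v + D.δ u v) =
          t ^ 2 * ((y v - p v) ^ 2 / (p v + D.δ u v)) := by
        simp only [z]; ring
      linarith
    have h7 : ∑ v ∈ D.children u, D.localGrad κ u p q v * (z v - p v) +
        ∑ v ∈ D.children u, z v * ĉ v - ∑ v ∈ D.children u, p v * ĉ v = t * S := by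
      rw [hS, Finset.mul_sum, ← Finset.sum_add_distrib, ← Finset.sum_sub_distrib]
      refine Finset.sum_congr rfl fun v _ => ?_
      simp only [z]; ring
    refine nonneg_of_mul_nonneg_right (a := t) ?_ h0
    nlinarith
  by_contra hneg
  push Not at hneg
  have hK0 : 0 ≤ K := by
    refine mul_nonneg (one_div_pos.2 hκ).le (Finset.sum_nonneg fun v hv => ?_)
    have hv := D.mem_children.1 hv
    have := add_pos_of_nonneg_of_pos (hp.1 v) (D.δ_pos hv)
    have := D.weight_pos hv
    positivity
  have h1 := key (min 1 (-S / (2 * (K + 1)))) (lt_min one_pos (div_pos (by linarith) (by linarith)))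
    (min_le_left _ _)
  have h2 : min 1 (-S / (2 * (K + 1))) * K ≤ -S / (2 * (K + 1)) * K :=
    mul_le_mul_of_nonneg_right (min_le_right _ _) hK0
  have h3 : -S / (2 * (K + 1)) * K ≤ -S / 2 := by
    rw [div_mul_eq_mul_div, div_le_div_iff₀ (by linarith) two_pos]
    nlinarith
  linarith

/-- The Karush-Kuhn-Tucker conditions. Here `β` is the multiplier of the constraint `∑ p = 1`, and
`s v` is the cost `ĉ v` minus the multiplier of the constraint `0 ≤ p v`. -/
theorem IsLocalArgmin.exists_multipliers {κ : ℝ} (hκ : 0 < κ) {u : V} {q ĉ p : V → ℝ}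
    (hq : q ∈ D.localSimplex u) (hc : ∀ v, 0 ≤ ĉ v) (h : D.IsLocalArgmin κ u q ĉ p) :
    ∃ (β : ℝ) (s : V → ℝ), 0 ≤ β ∧ ∀ v, D.arc u v → D.localGrad κ u p q v = β - s v ∧
      0 ≤ s v ∧ s v ≤ ĉ v ∧ p v * s v = p v * ĉ v := by
  classical
  have hp := h.1
  set G := D.localGrad κ u p q with hG
  set β := ∑ v ∈ D.children u, p v * (G v + ĉ v) with hβ
  have hle (w : V) (hw : D.arc u w) : β ≤ G w + ĉ w := by
    have hy : Pi.single w 1 ∈ D.localSimplex u := by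
      refine ⟨fun v => ?_, fun v hv => ?_, ?_⟩
      · by_cases hvw : v = w
        · subst hvw; simp
        · simp [hvw]
      · have : v ≠ w := fun hvw => hv (hvw ▸ hw)
        simp [this]
      · simp [Pi.single_apply, D.mem_children.2 hw]
    have h1 := IsLocalArgmin.variational D hκ hq.1 h hy
    have h2 : ∑ v ∈ D.children u, (G v + ĉ v) * ((Pi.single w 1 : V → ℝ) v - p v) =
        (G w + ĉ w) - β := by
      simp only [hβ, mul_sub, Finset.sum_sub_distrib, Pi.single_apply, mul_ite, mul_one, mul_zero,
        Finset.sum_ite_eq', D.mem_children.2 hw, if_true]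
      simp only [mul_comm]
    linarith
  have hzero : ∀ v ∈ D.children u, p v * (G v + ĉ v - β) = 0 := by
    refine (Finset.sum_eq_zero_iff_of_nonneg fun v hv => ?_).1 ?_
    · exact mul_nonneg (hp.1 v) (by linarith [hle v (D.mem_children.1 hv)])
    · simp only [mul_sub, Finset.sum_sub_distrib, ← Finset.sum_mul, hp.2.2]
      rw [← hβ]; ring
  have hneg {v : V} (hv : D.arc u v) (hG0 : G v < 0) : p v < q v := by
    by_contra hle'
    push Not at hle'
    have h1 : 0 < q v + D.δ u v := add_pos_of_nonneg_of_pos (hq.1 v) (D.δ_pos hv)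
    have h2 : 0 ≤ Real.log ((p v + D.δ u v) / (q v + D.δ u v)) :=
      Real.log_nonneg ((one_le_div h1).2 (by linarith))
    have h3 := mul_nonneg (one_div_pos.2 hκ).le (mul_nonneg (D.weight_pos hv).le h2)
    exact absurd hG0 (not_lt.2 h3)
  have hpos {v : V} (hv : D.arc u v) (hp0 : p v = 0) : G v ≤ 0 := by
    have hd := D.δ_pos hv
    have h1 : 0 < q v + D.δ u v := add_pos_of_nonneg_of_pos (hq.1 v) hd
    have h2 : Real.log ((p v + D.δ u v) / (q v + D.δ u v)) ≤ 0 := by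
      refine Real.log_nonpos (div_nonneg (by linarith [hp.1 v]) h1.le) ((div_le_one h1).2 ?_)
      linarith [hq.1 v]
    exact mul_nonpos_of_nonneg_of_nonpos (one_div_pos.2 hκ).le
      (mul_nonpos_of_nonneg_of_nonpos (D.weight_pos hv).le h2)
  have hβ0 : 0 ≤ β := by
    by_contra hβ0
    push Not at hβ0
    -- A negative multiplier would decrease all coordinates, strictly on the support of `p`.
    have h1 : ∀ v ∈ D.children u, p v ≤ q v := by
      intro v hv
      by_cases h0 : p v = 0
      · rw [h0]; exact hq.1 v
      · refine (hneg (D.mem_children.1 hv) ?_).le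
        have := (mul_eq_zero.1 (hzero v hv)).resolve_left h0
        linarith [hc v]
    obtain ⟨w, hw, hw0⟩ : ∃ w ∈ D.children u, p w ≠ 0 := by
      by_contra hne
      push Not at hne
      have := hp.2.2
      rw [Finset.sum_eq_zero hne] at this
      exact zero_ne_one this
    have h2 : p w < q w := by
      refine hneg (D.mem_children.1 hw) ?_
      have := (mul_eq_zero.1 (hzero w hw)).resolve_left hw0
      linarith [hc w]
    have := Finset.sum_lt_sum h1 ⟨w, hw, h2⟩
    rw [hp.2.2, hq.2.2] at this
    exact lt_irrefl _ this
  refine ⟨β, fun v => β - G v, hβ0, fun v hv => ⟨by ring, ?_, by linarith [hle v hv], ?_⟩⟩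
  · by_cases h0 : p v = 0
    · linarith [hpos hv h0]
    · have := (mul_eq_zero.1 (hzero v (D.mem_children.2 hv))).resolve_left h0
      linarith [hc v]
  · linarith [hzero v (D.mem_children.2 hv)]

/-- Mirror descent moves closer to every point `y` by at least the excess cost over `y`. -/
theorem IsLocalArgmin.localDiv_sub_le {κ : ℝ} (hκ : 0 < κ) {u : V} {q ĉ p : V → ℝ}
    (hq : ∀ v, 0 ≤ q v) (h : D.IsLocalArgmin κ u q ĉ p) {y : V → ℝ} (hy : y ∈ D.localSimplex u) :
    D.localDiv κ u y p + D.localDiv κ u p q - D.localDiv κ u y q ≤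
      ∑ v ∈ D.children u, y v * ĉ v - ∑ v ∈ D.children u, p v * ĉ v := by
  have h1 := D.localDiv_three_point κ u hy.1 h.1.1 hq
  have h2 := IsLocalArgmin.variational D hκ hq h hy
  have h3 : ∑ v ∈ D.children u, (D.localGrad κ u p q v + ĉ v) * (y v - p v) =
      ∑ v ∈ D.children u, D.localGrad κ u p q v * (y v - p v) +
      (∑ v ∈ D.children u, y v * ĉ v - ∑ v ∈ D.children u, p v * ĉ v) := by
    rw [← Finset.sum_sub_distrib, ← Finset.sum_add_distrib]
    exact Finset.sum_congr rfl fun v _ => by ring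
  linarith

theorem IsLocalArgmin.localDiv_le {κ : ℝ} (hκ : 0 < κ) {u : V} {q ĉ p : V → ℝ}
    (hq : q ∈ D.localSimplex u) (h : D.IsLocalArgmin κ u q ĉ p) :
    D.localDiv κ u p q ≤ ∑ v ∈ D.children u, (q v - p v) * ĉ v := by
  have h1 := IsLocalArgmin.localDiv_sub_le D hκ hq.1 h hq
  rw [D.localDiv_self κ u hq.1] at h1
  have := D.localDiv_nonneg hκ u hq.1 h.1.1
  simp only [sub_mul, Finset.sum_sub_distrib]
  linarith

/-- With the multipliers `s` in place of the costs, the three-point estimate is an equality. It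
controls the cost of a point `y` by the change of the divergence from `y`. -/
theorem sum_mul_multiplier_eq {κ β : ℝ} {u : V} {q p y ĉ s : V → ℝ}
    (hq : ∀ v, 0 ≤ q v) (hp : p ∈ D.localSimplex u) (hy : y ∈ D.localSimplex u)
    (hs : ∀ v, D.arc u v → D.localGrad κ u p q v = β - s v ∧ p v * s v = p v * ĉ v) :
    ∑ v ∈ D.children u, y v * s v = ∑ v ∈ D.children u, p v * ĉ v + D.localDiv κ u p q +
      (D.localDiv κ u y p - D.localDiv κ u y q) := by
  rw [D.localDiv_three_point κ u hy.1 hp.1 hq]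
  have h1 : ∑ v ∈ D.children u, D.localGrad κ u p q v * (y v - p v) =
      ∑ v ∈ D.children u, (β * y v - β * p v - y v * s v + p v * ĉ v) := by
    refine Finset.sum_congr rfl fun v hv => ?_
    obtain ⟨h1, h2⟩ := hs v (D.mem_children.1 hv)
    rw [h1, ← h2]; ring
  rw [h1]
  simp only [Finset.sum_add_distrib, Finset.sum_sub_distrib, ← Finset.mul_sum, hp.2.2, hy.2.2]
  ring

/-- The mass that leaves an arc is controlled by the cost of the arc. -/
theorem ω_mul_max_sub_le {κ β : ℝ} (hκ : 0 < κ) (hβ : 0 ≤ β) {u v : V} (huv : D.arc u v)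
    {q p : V → ℝ} {s : ℝ} (hq : 0 ≤ q v) (hp : 0 ≤ p v) (hs : 0 ≤ s)
    (h : D.localGrad κ u p q v = β - s) :
    D.ω u v * max (q v - p v) 0 ≤ κ * ((D.η u v * q v + D.θ u v) * s) := by
  have hd := D.δ_pos huv
  have hη := D.η_pos huv
  have hω := D.ω_pos u v huv
  have hθ := D.θ_pos u v huv
  rcases le_total (q v - p v) 0 with h0 | h0
  · rw [max_eq_right h0, mul_zero]; positivity
  · rw [max_eq_left h0]
    have h1 := mul_log_div_add_sub_nonneg (add_pos_of_nonneg_of_pos hq hd)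
      (add_pos_of_nonneg_of_pos hp hd)
    rw [← inv_div, Real.log_inv] at h1
    unfold localGrad at h
    set l := Real.log ((p v + D.δ u v) / (q v + D.δ u v))
    have h2 : -l * D.ω u v = κ * D.η u v * (s - β) := by
      have : D.ω u v * l = κ * D.η u v * (β - s) := by
        rw [← h]; field_simp
      linarith
    have h3 : (q v + D.δ u v) * D.η u v = D.η u v * q v + D.θ u v := by
      unfold δ; field_simp
    calc D.ω u v * (q v - p v) ≤ D.ω u v * ((q v + D.δ u v) * -l) :=
          mul_le_mul_of_nonneg_left (by linarith) hω.le
      _ = (q v + D.δ u v) * (-l * D.ω u v) := by ring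
      _ = κ * (((q v + D.δ u v) * D.η u v) * (s - β)) := by rw [h2]; ring
      _ = κ * ((D.η u v * q v + D.θ u v) * (s - β)) := by rw [h3]
      _ ≤ _ := by
          refine mul_le_mul_of_nonneg_left (mul_le_mul_of_nonneg_left (by linarith) ?_) hκ.le
          positivity

/-! ### The service cost and the divergence from a comparator -/

theorem step_isLocalArgmin {κ : ℝ} (hκ : 0 < κ) {q : V → V → ℝ} (hq : q ∈ D.states) (c : X → ℝ)
    {u : V} (hu : u ∉ X) :
    D.IsLocalArgmin κ u (q u) (D.hatCost κ q c) (D.step κ q c u) := by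
  rw [step, if_neg hu]
  exact D.localArgmin_spec hκ hu (D.states_nonneg hq u) _

open Classical in
/-- A function on the sinks, extended by zero to all vertices. -/
def sinkExtend (c : X → ℝ) (u : V) : ℝ := if h : u ∈ X then c ⟨u, h⟩ else 0

theorem sum_mul_sinkExtend (N : V → ℝ) (c : X → ℝ) :
    ∑ u, N u * sinkExtend c u = ∑ x : X, N x * c x := by
  classical
  rw [← Finset.sum_subset (Finset.subset_univ X) fun u _ hu => by simp [sinkExtend, hu],
    ← Finset.sum_coe_sort X]
  exact Finset.sum_congr rfl fun x _ => by simp [sinkExtend]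

theorem hatCost_value (κ : ℝ) (q : V → V → ℝ) (c : X → ℝ) (u : V) :
    D.hatCost κ q c u = sinkExtend c u +
      ∑ v ∈ D.children u, D.step κ q c u v * D.hatCost κ q c v := by
  by_cases hu : u ∈ X
  · rw [D.children_eq_empty hu, Finset.sum_empty, add_zero, sinkExtend, dif_pos hu]
    exact D.hatCost_sink κ q c ⟨u, hu⟩
  · rw [sinkExtend, dif_neg hu, zero_add]
    exact D.hatCost_eq κ q c hu

theorem hatCost_nonneg {κ : ℝ} (hκ : 0 < κ) {q : V → V → ℝ} (hq : q ∈ D.states) {c : X → ℝ}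
    (hc : ∀ x, 0 ≤ c x) (u : V) : 0 ≤ D.hatCost κ q c u := by
  refine D.value_nonneg (D.step_mem_states hκ hq c) (D.hatCost_value κ q c) (fun u => ?_) u
  unfold sinkExtend
  split_ifs with h
  · exact hc _
  · exact le_rfl

theorem hatCost_le {κ ε : ℝ} (hκ : 0 < κ) {q : V → V → ℝ} (hq : q ∈ D.states) {c : X → ℝ}
    (hε : 0 ≤ ε) (hc : ∀ x, c x ≤ ε) (u : V) : D.hatCost κ q c u ≤ ε := by
  refine D.value_le (D.step_mem_states hκ hq c) (D.hatCost_value κ q c) (B := fun _ => ε)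
    (fun u => ?_) u
  by_cases hu : u ∈ X
  · simpa [D.children_eq_empty hu, sinkExtend, hu] using hc ⟨u, hu⟩
  · rw [sinkExtend, dif_neg hu, zero_add]
    exact D.sum_state_mul_le (D.step_mem_states hκ hq c) hε fun _ _ => le_rfl

theorem ne_root_of_mem (hr : D.root ∉ X) {x : V} (hx : x ∈ X) : x ≠ D.root :=
  fun h => hr (h ▸ hx)

theorem played_eq_nodeFlow (hr : D.root ∉ X) (q : V → V → ℝ) (x : X) :
    D.played q x = D.nodeFlow q x :=
  (D.nodeFlow_eq q (D.ne_root_of_mem hr x.2)).symm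

/-- The value of the root is the expected reward at the sinks. -/
theorem value_root_eq_sum_played (hr : D.root ∉ X) {q : V → V → ℝ} {H : V → ℝ} {c : X → ℝ}
    (hH : ∀ u, H u = sinkExtend c u + ∑ v ∈ D.children u, q u v * H v) :
    H D.root = ∑ x, c x * D.played q x := by
  rw [← D.sum_nodeFlow_value_self hH, sum_mul_sinkExtend]
  exact Finset.sum_congr rfl fun x _ => by rw [D.played_eq_nodeFlow hr, mul_comm]

theorem hatCost_root (hr : D.root ∉ X) (κ : ℝ) (q : V → V → ℝ) (c : X → ℝ) :
    D.hatCost κ q c D.root = ∑ x, c x * D.played (D.step κ q c) x :=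
  D.value_root_eq_sum_played hr (D.hatCost_value κ q c)

/-- The divergence of the state `p` from the comparator `z`: the local divergences, weighted by the
flow of the comparator. -/
def globalDiv (κ : ℝ) (z p : V → V → ℝ) : ℝ :=
  ∑ u, D.nodeFlow z u * D.localDiv κ u (z u) (p u)

theorem globalDiv_nonneg {κ : ℝ} (hκ : 0 < κ) {z p : V → V → ℝ} (hz : z ∈ D.states)
    (hp : p ∈ D.states) : 0 ≤ D.globalDiv κ z p :=
  Finset.sum_nonneg fun u _ => mul_nonneg (D.nodeFlow_nonneg hz u)
    (D.localDiv_nonneg hκ u (D.states_nonneg hz u) (D.states_nonneg hp u))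

/-- Summed with the weights of the comparator's flow, the local excess costs telescope to the
excess of the service cost. -/
theorem globalDiv_step_sub_le (hr : D.root ∉ X) {κ : ℝ} (hκ : 0 < κ) {z q : V → V → ℝ}
    (hz : z ∈ D.states) (hq : q ∈ D.states) (c : X → ℝ) :
    D.globalDiv κ z (D.step κ q c) - D.globalDiv κ z q ≤
      ∑ x, c x * D.played z x - ∑ x, c x * D.played (D.step κ q c) x := by
  set p := D.step κ q c with hp
  set ĉ := D.hatCost κ q c
  have h1 := D.sum_nodeFlow_value (D.hatCost_value κ q c) z
  rw [D.hatCost_root hr, sum_mul_sinkExtend] at h1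
  have h2 : ∑ x, c x * D.played z x = ∑ x : X, D.nodeFlow z x * c x :=
    Finset.sum_congr rfl fun x _ => by rw [D.played_eq_nodeFlow hr, mul_comm]
  have h3 : D.globalDiv κ z p - D.globalDiv κ z q ≤
      ∑ u, D.nodeFlow z u * ∑ v ∈ D.children u, (z u v - p u v) * ĉ v := by
    unfold globalDiv
    rw [← Finset.sum_sub_distrib]
    refine Finset.sum_le_sum fun u _ => ?_
    rw [← mul_sub]
    refine mul_le_mul_of_nonneg_left ?_ (D.nodeFlow_nonneg hz u)
    by_cases hu : u ∈ X
    · simp [localDiv, D.children_eq_empty hu]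
    · have h4 := IsLocalArgmin.localDiv_sub_le D hκ (D.states_nonneg hq u)
        (D.step_isLocalArgmin hκ hq c hu) (hz.1 u hu)
      have h5 := D.localDiv_nonneg hκ u (D.states_nonneg (D.step_mem_states hκ hq c) u)
        (D.states_nonneg hq u)
      simp only [sub_mul, Finset.sum_sub_distrib]
      linarith
  linarith

/-! ### Dependence of the divergence on the comparator -/

theorem θ_le_one {u v : V} (h : D.arc u v) : D.θ u v ≤ 1 := by
  classical
  rw [← D.θ_sum u (D.not_mem_of_arc h)]
  exact Finset.single_le_sum (f := fun v => D.θ u v)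
    (fun w hw => (D.θ_pos u w (by simpa using hw)).le) (by simpa using h)

theorem sum_θ {u : V} (hu : u ∉ X) : ∑ v ∈ D.children u, D.θ u v = 1 := D.θ_sum u hu

theorem δ_le_θ {u v : V} (h : D.arc u v) : D.δ u v ≤ D.θ u v :=
  div_le_self (D.θ_pos u v h).le (D.one_le_η h)

theorem state_le_one {q : V → V → ℝ} (hq : q ∈ D.states) {u v : V} (h : D.arc u v) :
    q u v ≤ 1 := by
  rw [← (hq.1 u (D.not_mem_of_arc h)).2.2]
  exact Finset.single_le_sum (fun w _ => D.states_nonneg hq u w) (D.mem_children.2 h)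

theorem log_ratio_le {u v : V} (h : D.arc u v) {a b : ℝ} (ha : 0 ≤ a) (ha1 : a ≤ 1) (hb : 0 ≤ b) :
    Real.log ((a + D.δ u v) / (b + D.δ u v)) ≤ 2 * D.η u v := by
  have hδ := D.δ_pos h
  have hθ := D.θ_pos u v h
  have hη := D.one_le_η h
  have h1 : (a + D.δ u v) / (b + D.δ u v) ≤ (D.θ u v + D.η u v) * (1 / D.θ u v) := by
    calc (a + D.δ u v) / (b + D.δ u v) ≤ (1 + D.δ u v) / D.δ u v := by gcongr; linarith
      _ = _ := by unfold δ; field_simp; ring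
  have h2 := Real.log_le_log (by positivity) h1
  rw [Real.log_mul (by positivity) (by positivity)] at h2
  have h3 := Real.log_le_sub_one_of_pos (show 0 < D.θ u v + D.η u v by positivity)
  have h4 := D.θ_le_one h
  have h5 : Real.log (1 / D.θ u v) = D.η u v - 1 := by unfold η; ring
  linarith

theorem abs_log_ratio_le {u v : V} (h : D.arc u v) {a b : ℝ} (ha : 0 ≤ a) (ha1 : a ≤ 1)
    (hb : 0 ≤ b) (hb1 : b ≤ 1) :
    |Real.log ((a + D.δ u v) / (b + D.δ u v))| ≤ 2 * D.η u v := by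
  refine abs_le.2 ⟨?_, D.log_ratio_le h ha ha1 hb⟩
  have := D.log_ratio_le h hb hb1 ha
  rw [← inv_div, Real.log_inv] at this
  linarith

/-- The total length-weighted difference of the flows of two states. -/
def flowDiff (z z' : V → V → ℝ) : ℝ :=
  ∑ u, ∑ v ∈ D.children u, D.ω u v * |D.Λ z u v - D.Λ z' u v|

theorem abs_nodeFlow_sub_le (z z' : V → V → ℝ) (u : V) :
    |D.nodeFlow z u - D.nodeFlow z' u| ≤ ∑ w ∈ D.parents u, |D.Λ z w u - D.Λ z' w u| := by
  by_cases hu : u = D.root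
  · subst hu
    simp [D.nodeFlow_root, D.parents_root]
  · rw [D.nodeFlow_eq z hu, D.nodeFlow_eq z' hu, inflow, inflow, ← Finset.sum_sub_distrib]
    exact Finset.abs_sum_le_sum_abs _ _

/-- The divergence is Lipschitz in the comparator. The summand of an arc is the perspective of a
convex function, so its increase is bounded by its gradient at the new comparator; the weights `η`
and shifts `δ` are chosen such that this gradient is of the order of the arc length. -/
theorem globalDiv_sub_le {m : V → ℝ} (hm : D.IsScale m) {κ : ℝ} (hκ : 0 < κ)
    {z z' p : V → V → ℝ} (hz : z ∈ D.states) (hz' : z' ∈ D.states) (hp : p ∈ D.states) :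
    D.globalDiv κ z' p - D.globalDiv κ z p ≤ 3 / κ * D.flowDiff z' z := by
  set N := D.nodeFlow z with hN
  set N' := D.nodeFlow z' with hN'
  have harc (u v : V) (h : D.arc u v) :
      N' u * (D.ω u v / D.η u v * ((z' u v + D.δ u v) *
        Real.log ((z' u v + D.δ u v) / (p u v + D.δ u v)) + p u v - z' u v)) -
      N u * (D.ω u v / D.η u v * ((z u v + D.δ u v) *
        Real.log ((z u v + D.δ u v) / (p u v + D.δ u v)) + p u v - z u v)) ≤
      2 * (D.ω u v * |D.Λ z' u v - D.Λ z u v|) +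
        m u * |N' u - N u| * (2 * D.θ u v + p u v + z' u v) := by
    have hδ := D.δ_pos h
    have hη := D.one_le_η h
    have hω := D.ω_pos u v h
    have hw := D.weight_pos h
    have h1 := D.states_nonneg hz u v
    have h1' := D.states_nonneg hz' u v
    have hp0 := D.states_nonneg hp u v
    have hl := D.abs_log_ratio_le h h1' (D.state_le_one hz' h) hp0 (D.state_le_one hp h)
    have hb := mul_log_div_add_sub_nonneg (add_pos_of_nonneg_of_pos h1 hδ)
      (add_pos_of_nonneg_of_pos h1' hδ)
    have hlog : Real.log ((z u v + D.δ u v) / (p u v + D.δ u v)) =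
        Real.log ((z u v + D.δ u v) / (z' u v + D.δ u v)) +
        Real.log ((z' u v + D.δ u v) / (p u v + D.δ u v)) := by
      rw [Real.log_div (by positivity) (by positivity), Real.log_div (by positivity)
        (by positivity), Real.log_div (by positivity) (by positivity)]
      ring
    rw [hlog]
    set l := Real.log ((z' u v + D.δ u v) / (p u v + D.δ u v))
    set l' := Real.log ((z u v + D.δ u v) / (z' u v + D.δ u v))
    have h2 : D.Λ z' u v - D.Λ z u v = N' u * z' u v - N u * z u v := rfl
    have h3 : D.ω u v / D.η u v * (l * (D.Λ z' u v - D.Λ z u v)) ≤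
        2 * (D.ω u v * |D.Λ z' u v - D.Λ z u v|) := by
      have h4 : l * (D.Λ z' u v - D.Λ z u v) ≤ 2 * D.η u v * |D.Λ z' u v - D.Λ z u v| := by
        refine (le_abs_self _).trans ?_
        rw [abs_mul]
        exact mul_le_mul_of_nonneg_right hl (abs_nonneg _)
      refine (mul_le_mul_of_nonneg_left h4 hw.le).trans (le_of_eq ?_)
      field_simp
    have h5 : D.ω u v / D.η u v * ((D.δ u v * l + p u v - z' u v) * (N' u - N u)) ≤
        m u * |N' u - N u| * (2 * D.θ u v + p u v + z' u v) := by
      have h6 : |D.δ u v * l + p u v - z' u v| ≤ D.η u v * (2 * D.θ u v + p u v + z' u v) := by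
        have h7 : |D.δ u v * l| ≤ D.η u v * (2 * D.θ u v) := by
          rw [abs_mul, abs_of_pos hδ]
          calc D.δ u v * |l| ≤ D.θ u v * (2 * D.η u v) :=
                mul_le_mul (D.δ_le_θ h) hl (abs_nonneg _) (D.θ_pos u v h).le
            _ = _ := by ring
        have h8 := abs_le.1 h7
        have h9 : p u v ≤ D.η u v * p u v := le_mul_of_one_le_left hp0 hη
        have h10 : z' u v ≤ D.η u v * z' u v := le_mul_of_one_le_left h1' hη
        rw [abs_le]
        constructor <;> linarith
      calc D.ω u v / D.η u v * ((D.δ u v * l + p u v - z' u v) * (N' u - N u))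
          ≤ D.ω u v / D.η u v *
            (D.η u v * (2 * D.θ u v + p u v + z' u v) * |N' u - N u|) := by
            refine mul_le_mul_of_nonneg_left ((le_abs_self _).trans ?_) hw.le
            rw [abs_mul]
            exact mul_le_mul_of_nonneg_right h6 (abs_nonneg _)
        _ = D.ω u v * (|N' u - N u| * (2 * D.θ u v + p u v + z' u v)) := by field_simp
        _ ≤ m u * (|N' u - N u| * (2 * D.θ u v + p u v + z' u v)) := by
            have := D.θ_pos u v h
            exact mul_le_mul_of_nonneg_right (hm.2.1 u v h) (by positivity)
        _ = _ := by ring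
    have h6 : 0 ≤ D.ω u v / D.η u v * (N u *
        ((z u v + D.δ u v) * l' + (z' u v + D.δ u v) - (z u v + D.δ u v))) :=
      mul_nonneg hw.le (mul_nonneg (D.nodeFlow_nonneg hz u) hb)
    rw [h2] at h3 ⊢
    linarith
  have hvert (u : V) : N' u * (κ * D.localDiv κ u (z' u) (p u)) -
      N u * (κ * D.localDiv κ u (z u) (p u)) ≤
      2 * ∑ v ∈ D.children u, D.ω u v * |D.Λ z' u v - D.Λ z u v| +
        4 * m u * |N' u - N u| := by
    by_cases hu : u ∈ X
    · have := hm.1 u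
      simp only [localDiv, D.children_eq_empty hu, Finset.sum_empty, mul_zero, sub_zero, zero_add]
      positivity
    · have h1 (y : V → ℝ) : κ * D.localDiv κ u y (p u) = ∑ v ∈ D.children u, D.ω u v / D.η u v *
          ((y v + D.δ u v) * Real.log ((y v + D.δ u v) / (p u v + D.δ u v)) + p u v - y v) := by
        unfold localDiv
        field_simp
      rw [h1, h1, Finset.mul_sum, Finset.mul_sum, ← Finset.sum_sub_distrib]
      refine (Finset.sum_le_sum fun v hv => harc u v (D.mem_children.1 hv)).trans (le_of_eq ?_)
      rw [Finset.sum_add_distrib, ← Finset.mul_sum, ← Finset.mul_sum]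
      simp only [Finset.sum_add_distrib, ← Finset.mul_sum]
      rw [D.sum_θ hu, (hp.1 u hu).2.2, (hz'.1 u hu).2.2]
      ring
  have hnode : ∑ u, 4 * m u * |N' u - N u| ≤ D.flowDiff z' z := by
    rw [flowDiff, D.sum_children_comm]
    refine Finset.sum_le_sum fun u _ => ?_
    have := hm.1 u
    calc 4 * m u * |N' u - N u| ≤ 4 * m u * ∑ w ∈ D.parents u, |D.Λ z' w u - D.Λ z w u| :=
          mul_le_mul_of_nonneg_left (D.abs_nodeFlow_sub_le z' z u) (by positivity)
      _ ≤ _ := by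
          rw [Finset.mul_sum]
          exact Finset.sum_le_sum fun w hw => mul_le_mul_of_nonneg_right
            (hm.2.2 w u (D.mem_parents.1 hw)) (abs_nonneg _)
  have htot : κ * (D.globalDiv κ z' p - D.globalDiv κ z p) ≤ 3 * D.flowDiff z' z := by
    have h1 : κ * (D.globalDiv κ z' p - D.globalDiv κ z p) =
        ∑ u, (N' u * (κ * D.localDiv κ u (z' u) (p u)) -
          N u * (κ * D.localDiv κ u (z u) (p u))) := by
      unfold globalDiv
      rw [← Finset.sum_sub_distrib, Finset.mul_sum]
      exact Finset.sum_congr rfl fun u _ => by ring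
    rw [h1]
    refine (Finset.sum_le_sum fun u _ => hvert u).trans ?_
    rw [Finset.sum_add_distrib, ← Finset.mul_sum]
    have : D.flowDiff z' z = ∑ u, ∑ v ∈ D.children u, D.ω u v * |D.Λ z' u v - D.Λ z u v| := rfl
    linarith
  rw [div_mul_eq_mul_div, le_div_iff₀ hκ]
  linarith

/-- The divergence from an arbitrary comparator is bounded. -/
theorem globalDiv_le {m : V → ℝ} (hm : D.IsScale m) {κ : ℝ} (hκ : 0 < κ)
    {z p : V → V → ℝ} (hz : z ∈ D.states) (hp : p ∈ D.states) :
    D.globalDiv κ z p ≤ 4 / 3 * (5 / κ) * m D.root := by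
  refine D.sum_nodeFlow_le_scale hm hz (div_pos (by norm_num) hκ).le fun u => ?_
  by_cases hu : u ∈ X
  · simp only [localDiv, D.children_eq_empty hu, Finset.sum_empty, mul_zero]
    exact mul_nonneg (div_pos (by norm_num) hκ).le (hm.1 u)
  · have h1 : ∑ v ∈ D.children u, D.ω u v / D.η u v * ((z u v + D.δ u v) *
        Real.log ((z u v + D.δ u v) / (p u v + D.δ u v)) + p u v - z u v) ≤
        ∑ v ∈ D.children u, m u * (2 * z u v + 2 * D.θ u v + p u v) := by
      refine Finset.sum_le_sum fun v hv => ?_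
      have h := D.mem_children.1 hv
      have hη := D.one_le_η h
      have hω := D.ω_pos u v h
      have h1 := D.states_nonneg hz u v
      have h2 := D.states_nonneg hp u v
      have h3 : (z u v + D.δ u v) * Real.log ((z u v + D.δ u v) / (p u v + D.δ u v)) ≤
          (z u v + D.θ u v) * (2 * D.η u v) := by
        have h4 := D.δ_le_θ h
        have h5 := D.δ_pos h
        exact (mul_le_mul_of_nonneg_left (D.log_ratio_le h h1 (D.state_le_one hz h) h2)
          (by positivity)).trans (mul_le_mul_of_nonneg_right (by linarith) (by positivity))
      have h6 : p u v ≤ D.η u v * p u v := le_mul_of_one_le_left h2 hη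
      have hθ := D.θ_pos u v h
      calc _ ≤ D.ω u v / D.η u v * (D.η u v * (2 * z u v + 2 * D.θ u v + p u v)) :=
            mul_le_mul_of_nonneg_left (by linarith) (D.weight_pos h).le
        _ = D.ω u v * (2 * z u v + 2 * D.θ u v + p u v) := by field_simp
        _ ≤ _ := mul_le_mul_of_nonneg_right (hm.2.1 u v h) (by positivity)
    have h2 : ∑ v ∈ D.children u, m u * (2 * z u v + 2 * D.θ u v + p u v) = 5 * m u := by
      rw [← Finset.mul_sum]
      simp only [Finset.sum_add_distrib, ← Finset.mul_sum]
      rw [D.sum_θ hu, (hp.1 u hu).2.2, (hz.1 u hu).2.2]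
      ring
    rw [h2] at h1
    calc D.localDiv κ u (z u) (p u) ≤ 1 / κ * (5 * m u) :=
          mul_le_mul_of_nonneg_left h1 (one_div_pos.2 hκ).le
      _ = _ := by ring

/-! ### Unit flows are the flows of states -/

theorem IsUnitFlow.root_notMem {F : V → V → ℝ} (hF : D.IsUnitFlow F) : D.root ∉ X := by
  intro h
  have := hF.unit
  rw [outflow, D.children_eq_empty h] at this
  simp at this

/-- Where the flow vanishes, the transition probabilities are arbitrary; `θ` is one choice. -/
theorem IsUnitFlow.exists_state {F : V → V → ℝ} (hF : D.IsUnitFlow F) :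
    ∃ z ∈ D.states, D.Λ z = F := by
  classical
  let z : V → V → ℝ := fun u v => if D.arc u v then
    (if D.outflow F u = 0 then D.θ u v else F u v / D.outflow F u) else 0
  have hout (u : V) : 0 ≤ D.outflow F u := Finset.sum_nonneg fun v _ => hF.nonneg u v
  have hmul (u v : V) : D.outflow F u * z u v = F u v := by
    by_cases h : D.arc u v
    · simp only [z, if_pos h]
      split_ifs with h0
      · rw [h0, zero_mul]
        exact ((Finset.sum_eq_zero_iff_of_nonneg fun v _ => hF.nonneg u v).1 h0 v
          (D.mem_children.2 h)).symm
      · field_simp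
    · simp [z, h, hF.eq_zero u v h]
  have hnode (u : V) (hu : u ∉ X) : D.nodeFlow z u = D.outflow F u := by
    induction u using D.wf_arc.induction with
    | _ u ih =>
      by_cases hur : u = D.root
      · rw [hur, D.nodeFlow_root, hF.unit]
      · rw [D.nodeFlow_eq z hur, hF.conservation u hu hur]
        refine Finset.sum_congr rfl fun w hw => ?_
        have hw := D.mem_parents.1 hw
        rw [Λ, ih w hw (D.not_mem_of_arc hw), hmul]
  refine ⟨z, ⟨fun u hu => ⟨fun v => ?_, fun v hv => by simp [z, hv], ?_⟩, fun u hu => ?_⟩, ?_⟩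
  · simp only [z]
    split_ifs with h h0
    · exact (D.θ_pos u v h).le
    · exact div_nonneg (hF.nonneg u v) (hout u)
    · exact le_rfl
  · by_cases h0 : D.outflow F u = 0
    · rw [← D.sum_θ hu]
      exact Finset.sum_congr rfl fun v hv => by simp [z, D.mem_children.1 hv, h0]
    · refine mul_left_cancel₀ h0 ?_
      rw [Finset.mul_sum, mul_one]
      exact Finset.sum_congr rfl fun v _ => hmul u v
  · funext v
    have : ¬ D.arc u v := fun h => D.not_mem_of_arc h hu
    simp [z, this]
  · funext u v
    by_cases hu : u ∈ X
    · have : ¬ D.arc u v := fun h => D.not_mem_of_arc h hu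
      simp [Λ, z, this, hF.eq_zero u v this]
    · rw [Λ, hnode u hu, hmul]

theorem sum_played (hr : D.root ∉ X) {q : V → V → ℝ} (hq : q ∈ D.states) :
    ∑ x, D.played q x = 1 := by
  have h := D.value_root_eq_sum_played hr (q := q) (H := fun _ => 1) (c := fun _ => 1) fun u => by
    by_cases hu : u ∈ X
    · simp [sinkExtend, hu, D.children_eq_empty hu]
    · simp [sinkExtend, hu, (hq.1 u hu).2.2]
  simpa using h.symm

theorem played_nonneg (hr : D.root ∉ X) {q : V → V → ℝ} (hq : q ∈ D.states) (x : X) :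
    0 ≤ D.played q x := by
  rw [D.played_eq_nodeFlow hr]
  exact D.nodeFlow_nonneg hq x

theorem played_eq_zero (hr : D.root ∉ X) {q : V → V → ℝ} (hq : q ∈ D.states) {x y : X}
    (hx : D.played q x = 1) (hxy : y ≠ x) : D.played q y = 0 := by
  classical
  have h1 := D.sum_played hr hq
  rw [← Finset.add_sum_erase _ _ (Finset.mem_univ x), hx] at h1
  exact (Finset.sum_eq_zero_iff_of_nonneg fun y _ => D.played_nonneg hr hq y).1 (by linarith) y
    (by simp [hxy])

/-! ### Movement towards and away from vertices -/

/-- The length-weighted mass that leaves the arcs when the transitions `q` are replaced by `p`. -/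
def moveDown (q p : V → V → ℝ) : ℝ :=
  ∑ u, D.nodeFlow q u * ∑ v ∈ D.children u, D.ω u v * max (q u v - p u v) 0

/-- The length-weighted mass that enters the arcs when the transitions `q` are replaced by `p`. -/
def moveUp (q p : V → V → ℝ) : ℝ :=
  ∑ u, D.nodeFlow q u * ∑ v ∈ D.children u, D.ω u v * max (p u v - q u v) 0

theorem moveDown_nonneg {q : V → V → ℝ} (hq : q ∈ D.states) (p : V → V → ℝ) :
    0 ≤ D.moveDown q p :=
  Finset.sum_nonneg fun u _ => mul_nonneg (D.nodeFlow_nonneg hq u) (Finset.sum_nonneg fun v hv =>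
    mul_nonneg (D.ω_pos u v (D.mem_children.1 hv)).le (le_max_right _ _))

theorem moveUp_nonneg {q : V → V → ℝ} (hq : q ∈ D.states) (p : V → V → ℝ) :
    0 ≤ D.moveUp q p :=
  Finset.sum_nonneg fun u _ => mul_nonneg (D.nodeFlow_nonneg hq u) (Finset.sum_nonneg fun v hv =>
    mul_nonneg (D.ω_pos u v (D.mem_children.1 hv)).le (le_max_right _ _))

/-- The expected length of the path of the chain `p`. -/
def meanLength (p : V → V → ℝ) : ℝ :=
  ∑ u, D.nodeFlow p u * ∑ v ∈ D.children u, p u v * D.ω u v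

theorem meanLength_nonneg {p : V → V → ℝ} (hp : p ∈ D.states) : 0 ≤ D.meanLength p :=
  Finset.sum_nonneg fun u _ => mul_nonneg (D.nodeFlow_nonneg hp u) (Finset.sum_nonneg fun v hv =>
    mul_nonneg (D.states_nonneg hp u v) (D.ω_pos u v (D.mem_children.1 hv)).le)

theorem sum_state_mul_ω_le {m : V → ℝ} (hm : D.IsScale m) {p : V → V → ℝ} (hp : p ∈ D.states)
    (u : V) : ∑ v ∈ D.children u, p u v * D.ω u v ≤ 1 * m u := by
  rw [one_mul]
  exact D.sum_state_mul_le hp (hm.1 u) fun v hv => hm.2.1 u v hv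

theorem meanLength_le {m : V → ℝ} (hm : D.IsScale m) {p : V → V → ℝ} (hp : p ∈ D.states) :
    D.meanLength p ≤ 4 / 3 * 1 * m D.root :=
  D.sum_nodeFlow_le_scale hm hp zero_le_one (D.sum_state_mul_ω_le hm hp)

/-- Mass that enters arcs increases the mean length, and mass that leaves arcs decreases it by
not much more than the length of the arc, since all later arcs together are shorter. -/
theorem moveUp_le {m : V → ℝ} (hm : D.IsScale m) {q p : V → V → ℝ} (hq : q ∈ D.states)
    (hp : p ∈ D.states) :
    D.moveUp q p ≤ 4 / 3 * D.moveDown q p + (D.meanLength p - D.meanLength q) := by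
  obtain ⟨H, hH⟩ := D.exists_value p fun u => ∑ v ∈ D.children u, p u v * D.ω u v
  have hH0 := D.value_nonneg hp hH fun u => Finset.sum_nonneg fun v hv =>
    mul_nonneg (D.states_nonneg hp u v) (D.ω_pos u v (D.mem_children.1 hv)).le
  have hH1 := D.value_le_scale hm hp hH zero_le_one (D.sum_state_mul_ω_le hm hp)
  have h1 := D.sum_nodeFlow_value_self hH
  have h2 := D.sum_nodeFlow_value hH q
  have h3 : D.moveUp q p - 4 / 3 * D.moveDown q p ≤
      ∑ u, D.nodeFlow q u * ∑ v ∈ D.children u, p u v * D.ω u v -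
      ∑ u, D.nodeFlow q u * ∑ v ∈ D.children u, q u v * D.ω u v -
      ∑ u, D.nodeFlow q u * ∑ v ∈ D.children u, (q u v - p u v) * H v := by
    unfold moveUp moveDown
    rw [Finset.mul_sum]
    simp only [← Finset.sum_sub_distrib]
    refine Finset.sum_le_sum fun u _ => ?_
    rw [mul_left_comm, ← mul_sub, ← mul_sub, ← mul_sub]
    refine mul_le_mul_of_nonneg_left ?_ (D.nodeFlow_nonneg hq u)
    rw [Finset.mul_sum]
    simp only [← Finset.sum_sub_distrib]
    refine Finset.sum_le_sum fun v hv => ?_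
    have hv := D.mem_children.1 hv
    have h4 : H v ≤ 1 / 3 * D.ω u v := by linarith [hH1 v, hm.2.2 u v hv]
    rcases le_total (q u v) (p u v) with h | h
    · rw [max_eq_left (sub_nonneg.2 h), max_eq_right (sub_nonpos.2 h)]
      have := mul_nonneg (sub_nonneg.2 h) (hH0 v)
      linarith
    · rw [max_eq_right (sub_nonpos.2 h), max_eq_left (sub_nonneg.2 h)]
      have := mul_le_mul_of_nonneg_left h4 (sub_nonneg.2 h)
      linarith
  have h4 : D.meanLength p = H D.root := h1
  have h5 : D.meanLength q = ∑ u, D.nodeFlow q u * ∑ v ∈ D.children u, q u v * D.ω u v := rfl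
  linarith

/-! ### The divergence from `θ` -/

open Classical in
/-- The state with the transition probabilities `θ`. -/
def prior (u v : V) : ℝ := if D.arc u v then D.θ u v else 0

theorem prior_of_arc {u v : V} (h : D.arc u v) : D.prior u v = D.θ u v := if_pos h

theorem prior_mem_states : D.prior ∈ D.states := by
  refine ⟨fun u hu => ⟨fun v => ?_, fun v hv => if_neg hv, ?_⟩, fun u hu => ?_⟩
  · unfold prior
    split_ifs with h
    · exact (D.θ_pos u v h).le
    · exact le_rfl
  · rw [← D.sum_θ hu]
    exact Finset.sum_congr rfl fun v hv => D.prior_of_arc (D.mem_children.1 hv)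
  · funext v
    exact if_neg fun h => D.not_mem_of_arc h hu

theorem one_add_mul_log_one_add_le {x : ℝ} (hx : 1 ≤ x) :
    (1 + x) * Real.log (1 + x) ≤ 7 / 5 * x ^ 2 := by
  have h1 : Real.log (1 + x) = Real.log 2 + Real.log ((1 + x) / 2) := by
    rw [← Real.log_mul (by norm_num) (by positivity)]
    congr 1; ring
  have h2 := Real.log_le_sub_one_of_pos (show 0 < (1 + x) / 2 by positivity)
  have h3 := Real.log_two_lt_d9
  have h4 : Real.log (1 + x) ≤ 7 / 10 + (x - 1) / 2 := by linarith
  have h5 := mul_le_mul_of_nonneg_left h4 (show 0 ≤ 1 + x by linarith)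
  nlinarith

/-- The constant `12 / 5` matters: the divergence from `θ` is paid for each unit of movement with
the factor `4 / 3` for the later arcs and the factor `1 / 4` for the ratio of consecutive arcs, and
the product of the three has to be less than one. -/
theorem localDiv_prior_le {m : V → ℝ} (hm : D.IsScale m) {κ : ℝ} (hκ : 0 < κ) {p : V → V → ℝ}
    (hp : p ∈ D.states) (u : V) : κ * D.localDiv κ u (D.prior u) (p u) ≤ 12 / 5 * m u := by
  by_cases hu : u ∈ X
  · have := hm.1 u
    simpa [localDiv, D.children_eq_empty hu] using this
  · have h1 : κ * D.localDiv κ u (D.prior u) (p u) = ∑ v ∈ D.children u, D.ω u v / D.η u v *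
        ((D.prior u v + D.δ u v) * Real.log ((D.prior u v + D.δ u v) / (p u v + D.δ u v)) +
          p u v - D.prior u v) := by
      unfold localDiv
      field_simp
    have h2 : 12 / 5 * m u = ∑ v ∈ D.children u, m u * (7 / 5 * D.θ u v + p u v) := by
      rw [← Finset.mul_sum]
      simp only [Finset.sum_add_distrib, ← Finset.mul_sum]
      rw [D.sum_θ hu, (hp.1 u hu).2.2]
      ring
    rw [h1, h2]
    refine Finset.sum_le_sum fun v hv => ?_
    have h := D.mem_children.1 hv
    rw [D.prior_of_arc h]
    have hθ := D.θ_pos u v h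
    have hη := D.one_le_η h
    have hδ := D.δ_pos h
    have hω := D.ω_pos u v h
    have hp0 := D.states_nonneg hp u v
    have h3 : Real.log ((D.θ u v + D.δ u v) / (p u v + D.δ u v)) ≤ Real.log (1 + D.η u v) := by
      refine Real.log_le_log (by positivity) ?_
      calc (D.θ u v + D.δ u v) / (p u v + D.δ u v) ≤ (D.θ u v + D.δ u v) / D.δ u v := by
            gcongr; linarith
        _ = 1 + D.η u v := by unfold δ; field_simp; ring
    have h4 : (D.θ u v + D.δ u v) * Real.log ((D.θ u v + D.δ u v) / (p u v + D.δ u v)) ≤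
        D.η u v * (7 / 5 * D.θ u v) := by
      calc _ ≤ (D.θ u v + D.δ u v) * Real.log (1 + D.η u v) :=
            mul_le_mul_of_nonneg_left h3 (by positivity)
        _ = D.θ u v / D.η u v * ((1 + D.η u v) * Real.log (1 + D.η u v)) := by
            unfold δ; field_simp; ring
        _ ≤ D.θ u v / D.η u v * (7 / 5 * D.η u v ^ 2) :=
            mul_le_mul_of_nonneg_left (one_add_mul_log_one_add_le hη) (by positivity)
        _ = _ := by field_simp
    have h5 : p u v ≤ D.η u v * p u v := le_mul_of_one_le_left hp0 hη
    calc _ ≤ D.ω u v / D.η u v * (D.η u v * (7 / 5 * D.θ u v + p u v)) :=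
          mul_le_mul_of_nonneg_left (by linarith) (D.weight_pos h).le
      _ = D.ω u v * (7 / 5 * D.θ u v + p u v) := by field_simp
      _ ≤ _ := mul_le_mul_of_nonneg_right (hm.2.1 u v h) (by positivity)

/-- The divergence from `θ`, weighted by the flow of the state `p` itself. -/
def priorDiv (κ : ℝ) (p : V → V → ℝ) : ℝ :=
  ∑ u, D.nodeFlow p u * (κ * D.localDiv κ u (D.prior u) (p u))

theorem priorDiv_nonneg {κ : ℝ} (hκ : 0 < κ) {p : V → V → ℝ} (hp : p ∈ D.states) :
    0 ≤ D.priorDiv κ p :=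
  Finset.sum_nonneg fun u _ => mul_nonneg (D.nodeFlow_nonneg hp u) (mul_nonneg hκ.le
    (D.localDiv_nonneg hκ u (D.states_nonneg D.prior_mem_states u) (D.states_nonneg hp u)))

theorem priorDiv_le {m : V → ℝ} (hm : D.IsScale m) {κ : ℝ} (hκ : 0 < κ) {p : V → V → ℝ}
    (hp : p ∈ D.states) : D.priorDiv κ p ≤ 4 / 3 * (12 / 5) * m D.root :=
  D.sum_nodeFlow_le_scale hm hp (by norm_num) (D.localDiv_prior_le hm hκ hp)

/-- Replacing the weights `q` by `p` in the divergence of `p` from `θ` is paid for by a fraction of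
the movement. -/
theorem sum_nodeFlow_mul_prior_le {m : V → ℝ} (hm : D.IsScale m) {κ : ℝ} (hκ : 0 < κ)
    {q p : V → V → ℝ} (hq : q ∈ D.states) (hp : p ∈ D.states) :
    ∑ u, D.nodeFlow q u * (κ * D.localDiv κ u (D.prior u) (p u)) ≤
      D.priorDiv κ p + 4 / 5 * D.moveDown q p := by
  obtain ⟨H, hH⟩ := D.exists_value p fun u => κ * D.localDiv κ u (D.prior u) (p u)
  have hH0 := D.value_nonneg hp hH fun u => mul_nonneg hκ.le
    (D.localDiv_nonneg hκ u (D.states_nonneg D.prior_mem_states u) (D.states_nonneg hp u))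
  have hH1 := D.value_le_scale hm hp hH (by norm_num) (D.localDiv_prior_le hm hκ hp)
  have h1 : D.priorDiv κ p = H D.root := D.sum_nodeFlow_value_self hH
  rw [D.sum_nodeFlow_value hH q, h1]
  have := D.sum_sub_mul_value_le (p := p) (B := 4 / 5) hq hH0 fun u v huv => by
    linarith [hH1 v, hm.2.2 u v huv]
  exact add_le_add le_rfl this

/-! ### Heights and numbers of paths -/

variable {D} in
/-- The path that starts with the arc `uv` and continues along `γ`. -/
def PathFrom.cons {u v : V} (h : D.arc u v) (γ : D.PathFrom v) : D.PathFrom u :=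
  ⟨u :: γ.1, by
    obtain ⟨l, h1, h2, x, hx, h3⟩ := γ
    refine ⟨List.isChain_cons.2 ⟨fun y hy => ?_, h1⟩, rfl, x, hx, ?_⟩
    · rw [Option.mem_def, h2, Option.some_inj] at hy
      exact hy ▸ h
    · cases l with
      | nil => simp at h2
      | cons a l => simpa using h3⟩

/-- The maximum number of arcs of a path from `u` to a sink. -/
def height (u : V) : ℕ := Finset.univ.sup (fun γ : D.PathFrom u => γ.1.length - 1)

theorem height_lt {u v : V} (h : D.arc u v) (hv : D.σ v ≠ 0) : D.height v + 1 ≤ D.height u := by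
  have : Nonempty (D.PathFrom v) := Fintype.card_pos_iff.1 (Nat.pos_of_ne_zero hv)
  obtain ⟨γ, -, hγ⟩ := Finset.exists_mem_eq_sup (Finset.univ : Finset (D.PathFrom v))
    Finset.univ_nonempty (fun γ => γ.1.length - 1)
  have h1 : (PathFrom.cons h γ).1.length - 1 ≤ D.height u :=
    Finset.le_sup (f := fun γ : D.PathFrom u => γ.1.length - 1) (Finset.mem_univ _)
  have h2 : 0 < γ.1.length := by
    rw [List.length_pos_iff]
    intro h0
    have := γ.2.2.1
    simp [h0] at this
  have h3 : (PathFrom.cons h γ).1.length = γ.1.length + 1 := rfl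
  have h4 : D.height v = γ.1.length - 1 := hγ
  omega

/-- The height plus the logarithm of the number of paths; at the root, this is the competitive
ratio up to constants. -/
def rank (u : V) : ℝ := D.height u + Real.log (D.σ u)

theorem rank_nonneg (u : V) : 0 ≤ D.rank u :=
  add_nonneg (Nat.cast_nonneg _) (Real.log_natCast_nonneg _)

/-- The choice of `θ` makes the sum of `η` along a path telescope. -/
theorem one_add_η_add_rank_le (hθ : ∀ u v, D.arc u v → D.θ u v = (D.σ v : ℝ) / (D.σ u : ℝ))
    {u v : V} (h : D.arc u v) : 1 + D.η u v + 2 * D.rank v ≤ 2 * D.rank u := by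
  have h1 := D.θ_pos u v h
  have hη := D.one_le_η h
  rw [hθ u v h] at h1
  have hv : D.σ v ≠ 0 := by
    intro h0
    simp [h0] at h1
  have hu : D.σ u ≠ 0 := by
    intro h0
    simp [h0] at h1
  have h2 : (D.height v : ℝ) + 1 ≤ D.height u := by exact_mod_cast D.height_lt h hv
  have h3 : D.η u v = 1 + (Real.log (D.σ u) - Real.log (D.σ v)) := by
    rw [η, hθ u v h, one_div_div, Real.log_div (Nat.cast_ne_zero.2 hu) (Nat.cast_ne_zero.2 hv)]
  unfold rank
  linarith

/-! ### The movement in one step -/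

/-- The movement in one step is bounded by the service cost and the change of the divergence from
`θ`, up to a fraction of the movement itself: `4 / 5` of it pays for the change of the weights of
that divergence, and three errors of at most `κ * (ε * R)` times the movement come from replacing
`q` by `p` in the transition probabilities and in the flow, and from the divergence of `p` from
`q`. -/
theorem moveDown_step_le (hr : D.root ∉ X)
    (hθ : ∀ u v, D.arc u v → D.θ u v = (D.σ v : ℝ) / (D.σ u : ℝ)) {m : V → ℝ}
    (hm : D.IsScale m) {κ : ℝ} (hκ : 0 < κ) {ε R : ℝ} (hε : 0 ≤ ε)
    (hR : ∀ u v, D.arc u v → D.η u v ≤ R * D.ω u v ∧ 2 * D.rank v ≤ R * D.ω u v)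
    {q : V → V → ℝ} (hq : q ∈ D.states) {c : X → ℝ} (hc : ∀ x, 0 ≤ c x ∧ c x ≤ ε) :
    D.moveDown q (D.step κ q c) ≤
      κ * (2 * D.rank D.root * ∑ x, c x * D.played (D.step κ q c) x) +
      (D.priorDiv κ (D.step κ q c) - D.priorDiv κ q) +
      (4 / 5 + 3 * κ * (ε * R)) * D.moveDown q (D.step κ q c) := by
  rw [← D.hatCost_root hr κ q c]
  have hp := D.step_mem_states hκ hq c
  have hc0 := D.hatCost_nonneg hκ hq fun x => (hc x).1
  have hcε := D.hatCost_le hκ hq hε fun x => (hc x).2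
  have hval := fun u (hu : u ∉ X) => D.hatCost_eq κ q c hu
  have hmin := fun u (hu : u ∉ X) => D.step_isLocalArgmin hκ hq c hu
  set p := D.step κ q c
  set ĉ := D.hatCost κ q c
  obtain ⟨H, hH⟩ := D.exists_value p fun u => ∑ v ∈ D.children u, p u v * ((1 + D.η u v) * ĉ v)
  have hg0 (u : V) : 0 ≤ ∑ v ∈ D.children u, p u v * ((1 + D.η u v) * ĉ v) :=
    Finset.sum_nonneg fun v hv => mul_nonneg (D.states_nonneg hp u v)
      (mul_nonneg (by linarith [D.one_le_η (D.mem_children.1 hv)]) (hc0 v))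
  have hH0 := D.value_nonneg hp hH hg0
  have hH1 (u : V) : H u ≤ 2 * D.rank u * ĉ u := by
    refine D.value_le hp hH (B := fun u => 2 * D.rank u * ĉ u) (fun u => ?_) u
    by_cases hu : u ∈ X
    · simpa [D.children_eq_empty hu] using
        mul_nonneg (mul_nonneg zero_le_two (D.rank_nonneg u)) (hc0 u)
    · rw [hval u hu, ← Finset.sum_add_distrib, Finset.mul_sum]
      refine Finset.sum_le_sum fun v hv => ?_
      have h1 := mul_le_mul_of_nonneg_right (D.one_add_η_add_rank_le hθ (D.mem_children.1 hv))
        (mul_nonneg (D.states_nonneg hp u v) (hc0 v))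
      linarith
  have hlocal (u : V) : ∑ v ∈ D.children u, D.ω u v * max (q u v - p u v) 0 ≤
      κ * ∑ v ∈ D.children u, p u v * ((1 + D.η u v) * ĉ v) +
      (κ * D.localDiv κ u (D.prior u) (p u) - κ * D.localDiv κ u (D.prior u) (q u)) +
      2 * κ * (ε * R) * ∑ v ∈ D.children u, D.ω u v * max (q u v - p u v) 0 := by
    by_cases hu : u ∈ X
    · simp [localDiv, D.children_eq_empty hu]
    · obtain ⟨β, s, hβ, hs⟩ := IsLocalArgmin.exists_multipliers D hκ (hq.1 u hu) hc0 (hmin u hu)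
      have h1 : ∑ v ∈ D.children u, D.ω u v * max (q u v - p u v) 0 ≤
          κ * ∑ v ∈ D.children u, (D.η u v * q u v + D.prior u v) * s v := by
        rw [Finset.mul_sum]
        refine Finset.sum_le_sum fun v hv => ?_
        have hv := D.mem_children.1 hv
        rw [D.prior_of_arc hv]
        exact D.ω_mul_max_sub_le hκ hβ hv (D.states_nonneg hq u v) (D.states_nonneg hp u v)
          (hs v hv).2.1 (hs v hv).1
      have h2 : ∑ v ∈ D.children u, (D.η u v * q u v) * s v ≤
          ∑ v ∈ D.children u, p u v * (D.η u v * ĉ v) +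
          ε * R * ∑ v ∈ D.children u, D.ω u v * max (q u v - p u v) 0 := by
        rw [Finset.mul_sum, ← Finset.sum_add_distrib]
        refine Finset.sum_le_sum fun v hv => ?_
        have hv := D.mem_children.1 hv
        obtain ⟨-, h0, h3, h4⟩ := hs v hv
        have h5 : (q u v - p u v) * (D.η u v * s v) ≤
            max (q u v - p u v) 0 * (R * D.ω u v * ε) :=
          mul_le_mul (le_max_left _ _) (mul_le_mul (hR u v hv).1 (h3.trans (hcε v)) h0
            ((D.η_pos hv).le.trans (hR u v hv).1)) (mul_nonneg (D.η_pos hv).le h0)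
            (le_max_right _ _)
        calc (D.η u v * q u v) * s v =
              D.η u v * (p u v * s v) + (q u v - p u v) * (D.η u v * s v) := by ring
          _ ≤ D.η u v * (p u v * ĉ v) + max (q u v - p u v) 0 * (R * D.ω u v * ε) := by
              rw [h4]; exact add_le_add le_rfl h5
          _ = _ := by ring
      have h3 := D.sum_mul_multiplier_eq (y := D.prior u) (D.states_nonneg hq u) (hp.1 u hu)
        (D.prior_mem_states.1 u hu) fun v hv => ⟨(hs v hv).1, (hs v hv).2.2.2⟩
      have h4 : D.localDiv κ u (p u) (q u) ≤
          ε * R * ∑ v ∈ D.children u, D.ω u v * max (q u v - p u v) 0 := by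
        refine (IsLocalArgmin.localDiv_le D hκ (hq.1 u hu) (hmin u hu)).trans ?_
        rw [Finset.mul_sum]
        refine Finset.sum_le_sum fun v hv => ?_
        have hv := D.mem_children.1 hv
        have h1R : 1 ≤ R * D.ω u v := (D.one_le_η hv).trans (hR u v hv).1
        calc (q u v - p u v) * ĉ v ≤ max (q u v - p u v) 0 * ε :=
              mul_le_mul (le_max_left _ _) (hcε v) (hc0 v) (le_max_right _ _)
          _ ≤ max (q u v - p u v) 0 * ε * (R * D.ω u v) :=
              le_mul_of_one_le_right (mul_nonneg (le_max_right _ _) hε) h1R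
          _ = _ := by ring
      have h5 : ∑ v ∈ D.children u, (D.η u v * q u v + D.prior u v) * s v =
          ∑ v ∈ D.children u, (D.η u v * q u v) * s v +
          ∑ v ∈ D.children u, D.prior u v * s v := by
        rw [← Finset.sum_add_distrib]
        exact Finset.sum_congr rfl fun v _ => by ring
      have h6 : ∑ v ∈ D.children u, p u v * ((1 + D.η u v) * ĉ v) =
          ∑ v ∈ D.children u, p u v * (D.η u v * ĉ v) + ∑ v ∈ D.children u, p u v * ĉ v := by
        rw [← Finset.sum_add_distrib]
        exact Finset.sum_congr rfl fun v _ => by ring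
      rw [h5, h3] at h1
      rw [h6]
      have h7 := mul_le_mul_of_nonneg_left (add_le_add h2 h4) hκ.le
      linarith
  have hsum : D.moveDown q p ≤
      κ * ∑ u, D.nodeFlow q u * ∑ v ∈ D.children u, p u v * ((1 + D.η u v) * ĉ v) +
      (∑ u, D.nodeFlow q u * (κ * D.localDiv κ u (D.prior u) (p u)) - D.priorDiv κ q) +
      2 * κ * (ε * R) * D.moveDown q p := by
    unfold moveDown priorDiv
    simp only [Finset.mul_sum (s := Finset.univ), ← Finset.sum_sub_distrib,
      ← Finset.sum_add_distrib]
    refine Finset.sum_le_sum fun u _ => ?_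
    refine (mul_le_mul_of_nonneg_left (hlocal u) (D.nodeFlow_nonneg hq u)).trans (le_of_eq ?_)
    ring
  have hG : ∑ u, D.nodeFlow q u * ∑ v ∈ D.children u, p u v * ((1 + D.η u v) * ĉ v) ≤
      2 * D.rank D.root * ĉ D.root + ε * R * D.moveDown q p := by
    rw [D.sum_nodeFlow_value hH q]
    refine add_le_add (hH1 _) (D.sum_sub_mul_value_le hq hH0 fun u v huv => ?_)
    have h1 := mul_le_mul_of_nonneg_left (hcε v) (mul_nonneg zero_le_two (D.rank_nonneg v))
    have h2 := mul_le_mul_of_nonneg_right (hR u v huv).2 hε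
    linarith [hH1 v]
  have hG' := mul_le_mul_of_nonneg_left hG hκ.le
  have hP := D.sum_nodeFlow_mul_prior_le hm hκ hq hp
  linarith

/-- On the finite graph, `η` and the rank are bounded by a common multiple of the arc lengths. -/
theorem exists_ratio_bound : ∃ R : ℝ, 0 ≤ R ∧
    ∀ u v, D.arc u v → D.η u v ≤ R * D.ω u v ∧ 2 * D.rank v ≤ R * D.ω u v := by
  have h0 (u v : V) (h : D.arc u v) : 0 ≤ (D.η u v + 2 * D.rank v) / D.ω u v :=
    div_nonneg (add_nonneg (D.η_pos h).le (mul_nonneg zero_le_two (D.rank_nonneg v)))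
      (D.ω_pos u v h).le
  have h1 (u : V) : 0 ≤ ∑ v ∈ D.children u, (D.η u v + 2 * D.rank v) / D.ω u v :=
    Finset.sum_nonneg fun v hv => h0 u v (D.mem_children.1 hv)
  refine ⟨∑ u, ∑ v ∈ D.children u, (D.η u v + 2 * D.rank v) / D.ω u v,
    Finset.sum_nonneg fun u _ => h1 u, fun u v h => ?_⟩
  have h2 : (D.η u v + 2 * D.rank v) / D.ω u v ≤
      ∑ u, ∑ v ∈ D.children u, (D.η u v + 2 * D.rank v) / D.ω u v :=
    (Finset.single_le_sum (f := fun v => (D.η u v + 2 * D.rank v) / D.ω u v)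
      (fun v hv => h0 u v (D.mem_children.1 hv)) (D.mem_children.2 h)).trans
    (Finset.single_le_sum (f := fun u => ∑ v ∈ D.children u, (D.η u v + 2 * D.rank v) / D.ω u v)
      (fun u _ => h1 u) (Finset.mem_univ u))
  rw [div_le_iff₀ (D.ω_pos u v h)] at h2
  have := D.η_pos h
  have := D.rank_nonneg v
  constructor <;> linarith

/-! ### Sums over paths -/

variable {D}

theorem PathFrom.exists_eq_cons {u : V} (γ : D.PathFrom u) : ∃ l, γ.1 = u :: l := by
  obtain ⟨l, h1, h2, h3⟩ := γ
  cases l with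
  | nil => simp at h2
  | cons a l =>
    rw [List.head?_cons, Option.some_inj] at h2
    subst h2
    exact ⟨l, rfl⟩

theorem PathFrom.eq_singleton {u : V} (hu : u ∈ X) (γ : D.PathFrom u) : γ.1 = [u] := by
  obtain ⟨l, hl⟩ := γ.exists_eq_cons
  cases l with
  | nil => exact hl
  | cons v l =>
    have h := γ.2.1
    rw [hl, List.isChain_cons_cons] at h
    exact absurd hu (D.not_mem_of_arc h.1)

theorem PathFrom.exists_cons {u : V} (hu : u ∉ X) (γ : D.PathFrom u) :
    ∃ (v : V) (h : D.arc u v) (γ' : D.PathFrom v), γ = γ'.cons h := by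
  obtain ⟨l, h1, h2, x, hx, h3⟩ := γ
  cases l with
  | nil => simp at h2
  | cons a l =>
    rw [List.head?_cons, Option.some_inj] at h2
    subst h2
    cases l with
    | nil =>
      rw [List.getLast?_singleton, Option.some_inj] at h3
      exact absurd (h3 ▸ hx) hu
    | cons v l =>
      rw [List.isChain_cons_cons] at h1
      exact ⟨v, h1.1, ⟨v :: l, h1.2, rfl, x, hx, by simpa using h3⟩, rfl⟩

theorem PathFrom.cons_val {u v : V} (h : D.arc u v) (γ : D.PathFrom v) :
    (γ.cons h).1 = u :: γ.1 := rfl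

variable (D)

theorem sum_pathFrom_sink {u : V} (hu : u ∈ X) (f : List V → ℝ) :
    ∑ γ : D.PathFrom u, f γ.1 = f [u] := by
  let γ₀ : D.PathFrom u := ⟨[u], List.isChain_singleton u, rfl, u, hu, rfl⟩
  rw [Fintype.sum_eq_single γ₀ fun γ hγ => absurd (Subtype.ext (γ.eq_singleton hu)) hγ]

/-- A path from a vertex that is not a sink is an arc followed by a path. -/
theorem sum_pathFrom {u : V} (hu : u ∉ X) (f : List V → ℝ) :
    ∑ γ : D.PathFrom u, f γ.1 = ∑ v ∈ D.children u, ∑ γ : D.PathFrom v, f (u :: γ.1) := by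
  rw [← Finset.sum_coe_sort (D.children u), ← Fintype.sum_sigma']
  symm
  refine Fintype.sum_bijective
    (fun s : (v : D.children u) × D.PathFrom v => s.2.cons (D.mem_children.1 s.1.2))
    ⟨?_, fun γ => ?_⟩ _ _ fun s => rfl
  · rintro ⟨⟨v, hv⟩, γ⟩ ⟨⟨w, hw⟩, γ'⟩ h
    have h1 : γ.1 = γ'.1 := (List.cons.inj (congrArg Subtype.val h)).2
    obtain rfl : v = w := by
      have h2 := γ.2.2.1
      rw [h1, γ'.2.2.1, Option.some_inj] at h2
      exact h2.symm
    rw [Subtype.ext h1]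
  · obtain ⟨v, h, γ', rfl⟩ := γ.exists_cons hu
    exact ⟨⟨⟨v, D.mem_children.2 h⟩, γ'⟩, rfl⟩

theorem arcProd_cons (f : V → V → ℝ) (u : V) {v : V} (γ : D.PathFrom v) :
    arcProd f (u :: γ.1) = f u v * arcProd f γ.1 := by
  obtain ⟨l, hl⟩ := γ.exists_eq_cons
  rw [hl, arcProd]

theorem getLast?_cons (u : V) {v : V} (γ : D.PathFrom v) :
    (u :: γ.1).getLast? = γ.1.getLast? := by
  obtain ⟨l, hl⟩ := γ.exists_eq_cons
  rw [hl, List.getLast?_cons_cons]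

theorem divergence_cons_same (ω : V → V → ℝ) (u : V) {v : V} (γ γ' : D.PathFrom v) :
    divergence ω (u :: γ.1) (u :: γ'.1) = divergence ω γ.1 γ'.1 := by
  obtain ⟨l, hl⟩ := γ.exists_eq_cons
  obtain ⟨l', hl'⟩ := γ'.exists_eq_cons
  rw [hl, hl', divergence, if_pos rfl]

theorem divergence_cons_ne (ω : V → V → ℝ) (u : V) {v w : V} (h : v ≠ w) (γ : D.PathFrom v)
    (γ' : D.PathFrom w) : divergence ω (u :: γ.1) (u :: γ'.1) = max (ω u v) (ω u w) := by
  obtain ⟨l, hl⟩ := γ.exists_eq_cons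
  obtain ⟨l', hl'⟩ := γ'.exists_eq_cons
  rw [hl, hl', divergence, if_neg h]

theorem divergence_nonneg {u : V} (γ γ' : D.PathFrom u) : 0 ≤ divergence D.ω γ.1 γ'.1 := by
  induction u using D.wf_arc_swap.induction with
  | _ u ih =>
    by_cases hu : u ∈ X
    · simp [γ.eq_singleton hu, divergence]
    · obtain ⟨v, hv, γ, rfl⟩ := γ.exists_cons hu
      obtain ⟨w, hw, γ', rfl⟩ := γ'.exists_cons hu
      rw [PathFrom.cons_val, PathFrom.cons_val]
      by_cases h : v = w
      · subst h
        rw [D.divergence_cons_same]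
        exact ih v hv γ γ'
      · rw [D.divergence_cons_ne _ _ h]
        exact (D.ω_pos u v hv).le.trans (le_max_left _ _)

theorem arcProd_nonneg {q : V → V → ℝ} (hq : q ∈ D.states) {u : V} (γ : D.PathFrom u) :
    0 ≤ arcProd q γ.1 := by
  induction u using D.wf_arc_swap.induction with
  | _ u ih =>
    by_cases hu : u ∈ X
    · simp [γ.eq_singleton hu, arcProd]
    · obtain ⟨v, hv, γ, rfl⟩ := γ.exists_cons hu
      rw [PathFrom.cons_val, D.arcProd_cons]
      exact mul_nonneg (D.states_nonneg hq u v) (ih v hv γ)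

theorem sum_arcProd {q : V → V → ℝ} (hq : q ∈ D.states) (u : V) :
    ∑ γ : D.PathFrom u, arcProd q γ.1 = 1 := by
  induction u using D.wf_arc_swap.induction with
  | _ u ih =>
    by_cases hu : u ∈ X
    · rw [D.sum_pathFrom_sink hu (arcProd q), arcProd]
      simp
    · rw [D.sum_pathFrom hu (arcProd q), ← (hq.1 u hu).2.2]
      refine Finset.sum_congr rfl fun v hv => ?_
      simp only [D.arcProd_cons, ← Finset.mul_sum]
      rw [ih v (D.mem_children.1 hv), mul_one]

/-- In the path measure of the flow of a state, paths without flow have weight zero. So the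
quotients `0 / 0` in its definition are harmless. -/
theorem pathMeasure_Λ {q : V → V → ℝ} (hq : q ∈ D.states) (γ : D.RootPath) :
    D.pathMeasure (D.Λ q) γ = arcProd q γ.1 := by
  have key (u : V) (γ : D.PathFrom u) (h0 : D.nodeFlow q u ≠ 0) :
      arcProd (fun u v => D.Λ q u v / D.outflow (D.Λ q) u) γ.1 = arcProd q γ.1 := by
    induction u using D.wf_arc_swap.induction with
    | _ u ih =>
      by_cases hu : u ∈ X
      · simp [γ.eq_singleton hu, arcProd]
      · obtain ⟨v, hv, γ, rfl⟩ := γ.exists_cons hu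
        rw [PathFrom.cons_val, D.arcProd_cons, D.arcProd_cons, D.outflow_Λ hq hu, Λ,
          mul_div_cancel_left₀ _ h0]
        by_cases hz : q u v = 0
        · rw [hz, zero_mul, zero_mul]
        · rw [ih v hv γ]
          have hvr : v ≠ D.root := fun h => (D.source_iff v).2 h u hv
          rw [D.nodeFlow_eq q hvr]
          refine (lt_of_lt_of_le ?_ (Finset.single_le_sum (f := fun w => D.Λ q w v)
            (fun w _ => mul_nonneg (D.nodeFlow_nonneg hq w) (D.states_nonneg hq w v))
            (D.mem_parents.2 hv))).ne'
          exact mul_pos ((D.nodeFlow_nonneg hq u).lt_of_ne' h0)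
            ((D.states_nonneg hq u v).lt_of_ne' hz)
  exact key _ γ (by rw [D.nodeFlow_root]; exact one_ne_zero)

/-- The distribution that is played is the distribution of the endpoint of the random path. -/
theorem sum_arcProd_endpoint (hr : D.root ∉ X) (q : V → V → ℝ) (c : X → ℝ) :
    ∑ γ : D.RootPath, arcProd q γ.1 * c (D.endpoint γ) = ∑ x, c x * D.played q x := by
  let G : List V → ℝ := fun l => arcProd q l * l.getLast?.elim 0 (sinkExtend c)
  have hG : ∑ γ : D.RootPath, arcProd q γ.1 * c (D.endpoint γ) = ∑ γ : D.RootPath, G γ.1 := by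
    refine Finset.sum_congr rfl fun γ _ => ?_
    simp only [G]
    rw [D.getLast?_eq_endpoint γ]
    simp [sinkExtend]
  rw [hG]
  refine D.value_root_eq_sum_played hr (H := fun u => ∑ γ : D.PathFrom u, G γ.1) fun u => ?_
  by_cases hu : u ∈ X
  · rw [D.sum_pathFrom_sink hu, D.children_eq_empty hu]
    simp [G, arcProd]
  · rw [D.sum_pathFrom hu, sinkExtend, dif_neg hu, zero_add]
    refine Finset.sum_congr rfl fun v _ => ?_
    rw [Finset.mul_sum]
    refine Finset.sum_congr rfl fun γ _ => ?_
    simp only [G]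
    rw [D.arcProd_cons, D.getLast?_cons, mul_assoc]

/-! ### Transportation of flows bounds the difference of flows -/

/-- `∑ f u v` over the arcs `uv` of the path with the given list of vertices. -/
def arcSum (f : V → V → ℝ) : List V → ℝ
  | u :: v :: l => f u v + arcSum f (v :: l)
  | _ => 0

theorem arcSum_cons (f : V → V → ℝ) (u : V) {v : V} (γ : D.PathFrom v) :
    arcSum f (u :: γ.1) = f u v + arcSum f γ.1 := by
  obtain ⟨l, hl⟩ := γ.exists_eq_cons
  rw [hl, arcSum]

theorem sum_arcProd_mul_arcSum {q : V → V → ℝ} (hq : q ∈ D.states) (a : V → V → ℝ) :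
    ∑ γ : D.RootPath, arcProd q γ.1 * arcSum a γ.1 =
      ∑ u, ∑ v ∈ D.children u, D.Λ q u v * a u v := by
  have h := D.sum_nodeFlow_value_self (p := q)
    (g := fun u => ∑ v ∈ D.children u, q u v * a u v)
    (H := fun u => ∑ γ : D.PathFrom u, arcProd q γ.1 * arcSum a γ.1) fun u => by
      by_cases hu : u ∈ X
      · rw [D.sum_pathFrom_sink hu (fun l => arcProd q l * arcSum a l), D.children_eq_empty hu]
        simp [arcSum]
      · rw [D.sum_pathFrom hu (fun l => arcProd q l * arcSum a l), ← Finset.sum_add_distrib]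
        refine Finset.sum_congr rfl fun v _ => ?_
        have h1 (γ : D.PathFrom v) : arcProd q (u :: γ.1) * arcSum a (u :: γ.1) =
            q u v * (arcProd q γ.1 * a u v + arcProd q γ.1 * arcSum a γ.1) := by
          rw [D.arcProd_cons, D.arcSum_cons]
          ring
        rw [Finset.sum_congr rfl fun γ _ => h1 γ, ← Finset.mul_sum, Finset.sum_add_distrib,
          ← Finset.sum_mul, D.sum_arcProd hq, one_mul, mul_add]
  rw [← h]
  simp only [Finset.mul_sum, Λ, mul_assoc]

theorem abs_arcSum_le {m : V → ℝ} (hm : D.IsScale m) {a : V → V → ℝ}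
    (ha : ∀ u v, D.arc u v → |a u v| ≤ D.ω u v) {u : V} (γ : D.PathFrom u) :
    |arcSum a γ.1| ≤ 4 / 3 * m u := by
  induction u using D.wf_arc_swap.induction with
  | _ u ih =>
    by_cases hu : u ∈ X
    · have := hm.1 u
      rw [γ.eq_singleton hu]
      simp only [arcSum, abs_zero]
      positivity
    · obtain ⟨v, hv, γ, rfl⟩ := γ.exists_cons hu
      rw [PathFrom.cons_val, D.arcSum_cons]
      have h1 := abs_add_le (a u v) (arcSum a γ.1)
      have h2 := ih v hv γ
      linarith [ha u v hv, hm.2.1 u v hv, hm.2.2 u v hv]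

theorem arcSum_sub_le {m : V → ℝ} (hm : D.IsScale m) {a : V → V → ℝ}
    (ha : ∀ u v, D.arc u v → |a u v| ≤ D.ω u v) {u : V} (γ γ' : D.PathFrom u) :
    arcSum a γ.1 - arcSum a γ'.1 ≤ 8 / 3 * divergence D.ω γ.1 γ'.1 := by
  induction u using D.wf_arc_swap.induction with
  | _ u ih =>
    by_cases hu : u ∈ X
    · rw [γ.eq_singleton hu, γ'.eq_singleton hu]
      simp [divergence]
    · obtain ⟨v, hv, γ, rfl⟩ := γ.exists_cons hu
      obtain ⟨w, hw, γ', rfl⟩ := γ'.exists_cons hu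
      rw [PathFrom.cons_val, PathFrom.cons_val, D.arcSum_cons, D.arcSum_cons]
      by_cases h : v = w
      · subst h
        rw [D.divergence_cons_same]
        linarith [ih v hv γ γ']
      · rw [D.divergence_cons_ne _ _ h]
        have h1 := (abs_le.1 (D.abs_arcSum_le hm ha γ)).2
        have h2 := (abs_le.1 (D.abs_arcSum_le hm ha γ')).1
        have h3 := (abs_le.1 (ha u v hv)).2
        have h4 := (abs_le.1 (ha u w hw)).1
        linarith [hm.2.2 u v hv, hm.2.2 u w hw, le_max_left (D.ω u v) (D.ω u w),
          le_max_right (D.ω u v) (D.ω u w)]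

/-- Two paths differ after their first divergence only, where the arc lengths decay
geometrically. -/
theorem flowDiff_le_of_coupling {m : V → ℝ} (hm : D.IsScale m) {z z' : V → V → ℝ}
    (hz : z ∈ D.states) (hz' : z' ∈ D.states) {π : D.RootPath → D.RootPath → ℝ}
    (h0 : ∀ a b, 0 ≤ π a b) (h1 : ∀ a, ∑ b, π a b = arcProd z a.1)
    (h2 : ∀ b, ∑ a, π a b = arcProd z' b.1) :
    D.flowDiff z z' ≤ 8 / 3 * ∑ a, ∑ b, π a b * D.pathDist a b := by
  let s : V → V → ℝ := fun u v =>
    if 0 ≤ D.Λ z u v - D.Λ z' u v then D.ω u v else -D.ω u v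
  have hs (u v : V) (h : D.arc u v) : |s u v| ≤ D.ω u v := by
    simp only [s]
    split_ifs
    · rw [abs_of_pos (D.ω_pos u v h)]
    · rw [abs_neg, abs_of_pos (D.ω_pos u v h)]
  have h3 : D.flowDiff z z' = ∑ a : D.RootPath, arcProd z a.1 * arcSum s a.1 -
      ∑ b : D.RootPath, arcProd z' b.1 * arcSum s b.1 := by
    rw [D.sum_arcProd_mul_arcSum hz, D.sum_arcProd_mul_arcSum hz', ← Finset.sum_sub_distrib]
    refine Finset.sum_congr rfl fun u _ => ?_
    rw [← Finset.sum_sub_distrib]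
    refine Finset.sum_congr rfl fun v _ => ?_
    simp only [s]
    split_ifs with h
    · rw [abs_of_nonneg h]; ring
    · rw [abs_of_neg (not_le.1 h)]; ring
  have h4 : ∑ b : D.RootPath, arcProd z' b.1 * arcSum s b.1 =
      ∑ a, ∑ b, π a b * arcSum s b.1 := by
    rw [Finset.sum_comm]
    exact Finset.sum_congr rfl fun b _ => by rw [← h2, Finset.sum_mul]
  rw [h3, h4, ← Finset.sum_sub_distrib, Finset.mul_sum]
  refine Finset.sum_le_sum fun a _ => ?_
  rw [← h1, Finset.sum_mul, ← Finset.sum_sub_distrib, Finset.mul_sum]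
  refine Finset.sum_le_sum fun b _ => ?_
  have := mul_le_mul_of_nonneg_left (D.arcSum_sub_le hm hs a b) (h0 a b)
  unfold pathDist
  linarith

/-! ### A coupling of the paths of two states -/

/-- The total variation distance of the transition probabilities of `q` and `p` at `u`. -/
def localTV (q p : V → V → ℝ) (u : V) : ℝ := ∑ v ∈ D.children u, max (q u v - p u v) 0

theorem localTV_comm {q p : V → V → ℝ} (hq : q ∈ D.states) (hp : p ∈ D.states) (u : V) :
    D.localTV q p u = D.localTV p q u := by
  by_cases hu : u ∈ X
  · simp [localTV, D.children_eq_empty hu]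
  · unfold localTV
    have h : ∑ v ∈ D.children u, (max (q u v - p u v) 0 - max (p u v - q u v) 0) =
        ∑ v ∈ D.children u, (q u v - p u v) := by
      refine Finset.sum_congr rfl fun v _ => ?_
      rcases le_total (q u v) (p u v) with h | h
      · rw [max_eq_right (sub_nonpos.2 h), max_eq_left (sub_nonneg.2 h)]; ring
      · rw [max_eq_left (sub_nonneg.2 h), max_eq_right (sub_nonpos.2 h)]; ring
    rw [Finset.sum_sub_distrib, Finset.sum_sub_distrib, (hq.1 u hu).2.2, (hp.1 u hu).2.2] at h
    linarith

open Classical in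
/-- The coupling of the random paths of the chains `q` and `p` that follow a common path as long as
possible: at each vertex the next steps are coupled maximally, and after the first divergence the
paths are independent. -/
def coupling (q p : V → V → ℝ) : List V → List V → ℝ
  | u₁ :: v₁ :: l₁, u₂ :: v₂ :: l₂ =>
      if v₁ = v₂ then min (q u₁ v₁) (p u₁ v₁) * coupling q p (v₁ :: l₁) (v₂ :: l₂)
      else max (q u₁ v₁ - p u₁ v₁) 0 * max (p u₂ v₂ - q u₂ v₂) 0 / D.localTV q p u₁ *
        (arcProd q (v₁ :: l₁) * arcProd p (v₂ :: l₂))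
  | _, _ => 1

theorem coupling_cons_same (q p : V → V → ℝ) (u : V) {v : V} (γ γ' : D.PathFrom v) :
    D.coupling q p (u :: γ.1) (u :: γ'.1) =
      min (q u v) (p u v) * D.coupling q p γ.1 γ'.1 := by
  obtain ⟨l, hl⟩ := γ.exists_eq_cons
  obtain ⟨l', hl'⟩ := γ'.exists_eq_cons
  rw [hl, hl', coupling, if_pos rfl]

theorem coupling_cons_ne (q p : V → V → ℝ) (u : V) {v w : V} (h : v ≠ w) (γ : D.PathFrom v)
    (γ' : D.PathFrom w) : D.coupling q p (u :: γ.1) (u :: γ'.1) =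
      max (q u v - p u v) 0 * max (p u w - q u w) 0 / D.localTV q p u *
        (arcProd q γ.1 * arcProd p γ'.1) := by
  obtain ⟨l, hl⟩ := γ.exists_eq_cons
  obtain ⟨l', hl'⟩ := γ'.exists_eq_cons
  rw [hl, hl', coupling, if_neg h]

theorem localTV_nonneg (q p : V → V → ℝ) (u : V) : 0 ≤ D.localTV q p u :=
  Finset.sum_nonneg fun _ _ => le_max_right _ _

theorem coupling_nonneg {q p : V → V → ℝ} (hq : q ∈ D.states) (hp : p ∈ D.states) {u : V}
    (γ γ' : D.PathFrom u) : 0 ≤ D.coupling q p γ.1 γ'.1 := by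
  induction u using D.wf_arc_swap.induction with
  | _ u ih =>
    by_cases hu : u ∈ X
    · rw [γ.eq_singleton hu, γ'.eq_singleton hu]
      simp [coupling]
    · obtain ⟨v, hv, γ, rfl⟩ := γ.exists_cons hu
      obtain ⟨w, hw, γ', rfl⟩ := γ'.exists_cons hu
      rw [PathFrom.cons_val, PathFrom.cons_val]
      by_cases h : v = w
      · subst h
        rw [D.coupling_cons_same]
        exact mul_nonneg (le_min (D.states_nonneg hq u v) (D.states_nonneg hp u v)) (ih v hv γ γ')
      · rw [D.coupling_cons_ne _ _ _ h]
        exact mul_nonneg (div_nonneg (mul_nonneg (le_max_right _ _) (le_max_right _ _))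
          (D.localTV_nonneg q p u)) (mul_nonneg (D.arcProd_nonneg hq γ) (D.arcProd_nonneg hp γ'))

theorem coupling_comm {q p : V → V → ℝ} (hq : q ∈ D.states) (hp : p ∈ D.states) {u : V}
    (γ γ' : D.PathFrom u) : D.coupling q p γ.1 γ'.1 = D.coupling p q γ'.1 γ.1 := by
  induction u using D.wf_arc_swap.induction with
  | _ u ih =>
    by_cases hu : u ∈ X
    · rw [γ.eq_singleton hu, γ'.eq_singleton hu]
      simp [coupling]
    · obtain ⟨v, hv, γ, rfl⟩ := γ.exists_cons hu
      obtain ⟨w, hw, γ', rfl⟩ := γ'.exists_cons hu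
      rw [PathFrom.cons_val, PathFrom.cons_val]
      by_cases h : v = w
      · subst h
        rw [D.coupling_cons_same, D.coupling_cons_same, ih v hv, min_comm]
      · rw [D.coupling_cons_ne _ _ _ h, D.coupling_cons_ne _ _ _ (Ne.symm h),
          D.localTV_comm hq hp]
        ring

/-- The excess of `q` over `p` at an arc, scaled by the total excess. The quotient is `0 / 0` only
where the excess vanishes. -/
theorem excess_mul_div (q p : V → V → ℝ) {u v : V} (h : D.arc u v) :
    max (q u v - p u v) 0 * D.localTV q p u / D.localTV q p u = max (q u v - p u v) 0 := by
  by_cases h0 : D.localTV q p u = 0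
  · rw [(Finset.sum_eq_zero_iff_of_nonneg fun _ _ => le_max_right _ _).1 h0 v
      (D.mem_children.2 h)]
    simp
  · rw [mul_div_cancel_right₀ _ h0]

theorem excess_mul_excess (a b : ℝ) : max (a - b) 0 * max (b - a) 0 = 0 := by
  rcases le_total a b with h | h
  · rw [max_eq_right (sub_nonpos.2 h), zero_mul]
  · rw [max_eq_right (sub_nonpos.2 h), mul_zero]

theorem sum_coupling {q p : V → V → ℝ} (hq : q ∈ D.states) (hp : p ∈ D.states) {u : V}
    (γ : D.PathFrom u) : ∑ γ' : D.PathFrom u, D.coupling q p γ.1 γ'.1 = arcProd q γ.1 := by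
  classical
  induction u using D.wf_arc_swap.induction with
  | _ u ih =>
    by_cases hu : u ∈ X
    · rw [D.sum_pathFrom_sink hu, γ.eq_singleton hu]
      simp [coupling, arcProd]
    · obtain ⟨v, hv, γ, rfl⟩ := γ.exists_cons hu
      rw [D.sum_pathFrom hu, PathFrom.cons_val, D.arcProd_cons]
      have h1 (w : V) : ∑ γ' : D.PathFrom w, D.coupling q p (u :: γ.1) (u :: γ'.1) =
          (if v = w then min (q u v) (p u v) * arcProd q γ.1 else 0) +
          max (q u v - p u v) 0 * max (p u w - q u w) 0 / D.localTV q p u * arcProd q γ.1 := by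
        by_cases h : v = w
        · subst h
          simp only [D.coupling_cons_same, ← Finset.mul_sum]
          rw [ih v hv, if_pos trivial, excess_mul_excess]
          simp
        · simp only [D.coupling_cons_ne _ _ _ h, ← Finset.mul_sum]
          rw [D.sum_arcProd hp, if_neg h]
          ring
      simp only [h1, Finset.sum_add_distrib, Finset.sum_ite_eq, D.mem_children.2 hv, if_true]
      rw [← Finset.sum_mul, ← Finset.sum_div, ← Finset.mul_sum]
      have h2 : ∑ w ∈ D.children u, max (p u w - q u w) 0 = D.localTV q p u :=
        D.localTV_comm hp hq u
      rw [h2, D.excess_mul_div q p hv, ← add_mul]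
      congr 1
      rcases le_total (q u v) (p u v) with h | h
      · rw [max_eq_right (sub_nonpos.2 h), min_eq_left h, add_zero]
      · rw [max_eq_left (sub_nonneg.2 h), min_eq_right h]; ring

theorem sum_coupling' {q p : V → V → ℝ} (hq : q ∈ D.states) (hp : p ∈ D.states) {u : V}
    (γ : D.PathFrom u) : ∑ γ' : D.PathFrom u, D.coupling q p γ'.1 γ.1 = arcProd p γ.1 := by
  rw [← D.sum_coupling hp hq γ]
  exact Finset.sum_congr rfl fun γ' _ => D.coupling_comm hq hp γ' γ

/-- The cost of the coupling: its two paths reach a vertex together at most as often as the path of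
`q` does. -/
theorem sum_coupling_mul_pathDist_le {q p : V → V → ℝ} (hq : q ∈ D.states) (hp : p ∈ D.states) :
    ∑ γ : D.RootPath, ∑ γ' : D.RootPath, D.coupling q p γ.1 γ'.1 * D.pathDist γ γ' ≤
      D.moveDown q p + D.moveUp q p := by
  classical
  let g : V → ℝ := fun u => ∑ v ∈ D.children u, D.ω u v * max (q u v - p u v) 0 +
    ∑ v ∈ D.children u, D.ω u v * max (p u v - q u v) 0
  obtain ⟨H, hH⟩ := D.exists_value q g
  have hg : D.moveDown q p + D.moveUp q p = H D.root := by
    rw [← D.sum_nodeFlow_value_self hH]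
    simp only [moveDown, moveUp, g, mul_add, Finset.sum_add_distrib]
  have hH0 := D.value_nonneg hq hH fun u => add_nonneg
    (Finset.sum_nonneg fun v hv => mul_nonneg (D.ω_pos u v (D.mem_children.1 hv)).le
      (le_max_right _ _))
    (Finset.sum_nonneg fun v hv => mul_nonneg (D.ω_pos u v (D.mem_children.1 hv)).le
      (le_max_right _ _))
  have key (u : V) : ∑ γ : D.PathFrom u, ∑ γ' : D.PathFrom u,
      D.coupling q p γ.1 γ'.1 * divergence D.ω γ.1 γ'.1 ≤ H u := by
    induction u using D.wf_arc_swap.induction with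
    | _ u ih =>
      by_cases hu : u ∈ X
      · refine le_trans (le_of_eq ?_) (hH0 u)
        refine Finset.sum_eq_zero fun γ _ => Finset.sum_eq_zero fun γ' _ => ?_
        rw [γ.eq_singleton hu, γ'.eq_singleton hu]
        simp [divergence]
      · have h1 : ∑ γ : D.PathFrom u, ∑ γ' : D.PathFrom u,
            D.coupling q p γ.1 γ'.1 * divergence D.ω γ.1 γ'.1 =
            ∑ v ∈ D.children u, ∑ w ∈ D.children u, ∑ γ : D.PathFrom v, ∑ γ' : D.PathFrom w,
              D.coupling q p (u :: γ.1) (u :: γ'.1) *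
                divergence D.ω (u :: γ.1) (u :: γ'.1) := by
          rw [D.sum_pathFrom hu fun l => ∑ γ' : D.PathFrom u,
            D.coupling q p l γ'.1 * divergence D.ω l γ'.1]
          refine Finset.sum_congr rfl fun v _ => ?_
          refine Eq.trans ?_ Finset.sum_comm
          exact Finset.sum_congr rfl fun γ _ => D.sum_pathFrom hu fun l =>
            D.coupling q p (u :: γ.1) l * divergence D.ω (u :: γ.1) l
        have h2 (v w : V) (hv : D.arc u v) (hw : D.arc u w) :
            ∑ γ : D.PathFrom v, ∑ γ' : D.PathFrom w, D.coupling q p (u :: γ.1) (u :: γ'.1) *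
              divergence D.ω (u :: γ.1) (u :: γ'.1) ≤
            (if v = w then q u v * H v else 0) +
              max (q u v - p u v) 0 * max (p u w - q u w) 0 / D.localTV q p u *
                (D.ω u v + D.ω u w) := by
          by_cases h : v = w
          · subst h
            simp only [D.coupling_cons_same, D.divergence_cons_same, mul_assoc, ← Finset.mul_sum]
            rw [if_pos trivial, excess_mul_excess]
            have h3 : min (q u v) (p u v) * ∑ γ : D.PathFrom v, ∑ γ' : D.PathFrom v,
                D.coupling q p γ.1 γ'.1 * divergence D.ω γ.1 γ'.1 ≤ q u v * H v :=
              (mul_le_mul_of_nonneg_left (ih v hv)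
                (le_min (D.states_nonneg hq u v) (D.states_nonneg hp u v))).trans
                (mul_le_mul_of_nonneg_right (min_le_left _ _) (hH0 v))
            simpa using h3
          · have h3 : ∑ γ : D.PathFrom v, ∑ γ' : D.PathFrom w,
                D.coupling q p (u :: γ.1) (u :: γ'.1) *
                  divergence D.ω (u :: γ.1) (u :: γ'.1) =
                max (q u v - p u v) 0 * max (p u w - q u w) 0 / D.localTV q p u *
                  max (D.ω u v) (D.ω u w) := by
              simp only [D.coupling_cons_ne _ _ _ h, D.divergence_cons_ne _ _ h,
                ← Finset.sum_mul, ← Finset.mul_sum]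
              rw [D.sum_arcProd hp, mul_one, D.sum_arcProd hq, mul_one]
            rw [h3, if_neg h, zero_add]
            refine mul_le_mul_of_nonneg_left (max_le ?_ ?_) (div_nonneg (mul_nonneg
              (le_max_right _ _) (le_max_right _ _)) (D.localTV_nonneg q p u))
            · linarith [D.ω_pos u w hw]
            · linarith [D.ω_pos u v hv]
        rw [h1, hH u]
        refine (Finset.sum_le_sum fun v hv => Finset.sum_le_sum fun w hw =>
          h2 v w (D.mem_children.1 hv) (D.mem_children.1 hw)).trans (le_of_eq ?_)
        have h4 : ∑ w ∈ D.children u, max (p u w - q u w) 0 = D.localTV q p u :=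
          D.localTV_comm hp hq u
        have h5 : ∑ v ∈ D.children u, ∑ w ∈ D.children u,
            max (q u v - p u v) 0 * max (p u w - q u w) 0 / D.localTV q p u * D.ω u v =
            ∑ v ∈ D.children u, D.ω u v * max (q u v - p u v) 0 := by
          refine Finset.sum_congr rfl fun v hv => ?_
          rw [← Finset.sum_mul, ← Finset.sum_div, ← Finset.mul_sum, h4,
            D.excess_mul_div q p (D.mem_children.1 hv), mul_comm]
        have h6 : ∑ v ∈ D.children u, ∑ w ∈ D.children u,
            max (q u v - p u v) 0 * max (p u w - q u w) 0 / D.localTV q p u * D.ω u w =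
            ∑ v ∈ D.children u, D.ω u v * max (p u v - q u v) 0 := by
          rw [Finset.sum_comm]
          refine Finset.sum_congr rfl fun w hw => ?_
          rw [← Finset.sum_mul, ← Finset.sum_div, ← Finset.sum_mul]
          have h7 := D.excess_mul_div p q (D.mem_children.1 hw)
          rw [D.localTV_comm hp hq] at h7
          have h8 : ∑ v ∈ D.children u, max (q u v - p u v) 0 = D.localTV q p u := rfl
          rw [h8, mul_comm (D.localTV q p u), h7, mul_comm]
        simp only [mul_add, Finset.sum_add_distrib, h5, h6, Finset.sum_ite_eq, g]
        rw [add_comm]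
        congr 1
        exact Finset.sum_congr rfl fun v hv => by rw [if_pos hv]
  rw [hg]
  exact key D.root

/-! ### Transportation costs -/

/-- The transportation cost of the images under `e` is at most the cost of the image of a
coupling. -/
theorem transportCost_le_of_coupling {α β : Type*} [Fintype α] [Fintype β] {d : β → β → ℝ}
    (hd : ∀ x y, 0 ≤ d x y) (e : α → β) {π : α → α → ℝ} (h0 : ∀ a b, 0 ≤ π a b)
    {μ ν : β → ℝ} (hμ : ∀ x, (open Classical in ∑ a, if e a = x then ∑ b, π a b else 0) = μ x)
    (hν : ∀ y, (open Classical in ∑ b, if e b = y then ∑ a, π a b else 0) = ν y) :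
    transportCost d μ ν ≤ ∑ a, ∑ b, π a b * d (e a) (e b) := by
  classical
  refine csInf_le ⟨0, ?_⟩ ⟨fun x y => ∑ a, ∑ b, if e a = x then (if e b = y then π a b else 0)
    else 0, fun x y => ?_, fun x => ?_, fun y => ?_, ?_⟩
  · rintro s ⟨ρ, hρ, -, -, rfl⟩
    exact Finset.sum_nonneg fun x _ => Finset.sum_nonneg fun y _ => mul_nonneg (hρ x y) (hd x y)
  · refine Finset.sum_nonneg fun a _ => Finset.sum_nonneg fun b _ => ?_
    split_ifs
    exacts [h0 a b, le_rfl, le_rfl]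
  · rw [← hμ x, Finset.sum_comm]
    refine Finset.sum_congr rfl fun a _ => ?_
    rw [Finset.sum_comm]
    split_ifs <;> simp
  · rw [← hν y, Finset.sum_comm]
    simp_rw [Finset.sum_comm (s := (Finset.univ : Finset β))]
    rw [Finset.sum_comm]
    refine Finset.sum_congr rfl fun b _ => ?_
    split_ifs <;> simp
  · simp only [Finset.sum_mul, ite_mul, zero_mul]
    symm
    calc _ = ∑ a, ∑ b, ∑ x, ∑ y, (if e a = x then (if e b = y then π a b * d x y else 0)
          else 0) := by
          simp_rw [Finset.sum_comm (s := (Finset.univ : Finset β)) (t := (Finset.univ : Finset α))]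
      _ = _ := by
          refine Finset.sum_congr rfl fun a _ => Finset.sum_congr rfl fun b _ => ?_
          rw [Finset.sum_eq_single (e a) (fun x _ hx => by simp [Ne.symm hx]) (by simp)]
          simp

theorem flowW_Λ_le {q p : V → V → ℝ} (hq : q ∈ D.states) (hp : p ∈ D.states) :
    D.flowW (D.Λ q) (D.Λ p) ≤ D.moveDown q p + D.moveUp q p := by
  refine (transportCost_le_of_coupling (e := id)
    (π := fun γ γ' : D.RootPath => D.coupling q p γ.1 γ'.1)
    (fun γ γ' => D.divergence_nonneg γ γ')
    (fun γ γ' => D.coupling_nonneg hq hp γ γ') (fun γ => ?_) (fun γ => ?_)).trans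
    (D.sum_coupling_mul_pathDist_le hq hp)
  · refine (Fintype.sum_eq_single γ fun a ha => if_neg ha).trans ((if_pos rfl).trans ?_)
    rw [D.sum_coupling hq hp, D.pathMeasure_Λ hq]
  · refine (Fintype.sum_eq_single γ fun a ha => if_neg ha).trans ((if_pos rfl).trans ?_)
    rw [D.sum_coupling' hq hp, D.pathMeasure_Λ hp]

theorem flowDiff_le_flowW {m : V → ℝ} (hm : D.IsScale m) {z z' : V → V → ℝ} (hz : z ∈ D.states)
    (hz' : z' ∈ D.states) : D.flowDiff z z' ≤ 8 / 3 * D.flowW (D.Λ z) (D.Λ z') := by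
  have h : 3 / 8 * D.flowDiff z z' ≤ D.flowW (D.Λ z) (D.Λ z') := by
    refine le_csInf ⟨_, fun γ γ' => D.coupling z z' γ.1 γ'.1,
      fun γ γ' => D.coupling_nonneg hz hz' γ γ', fun γ => ?_, fun γ => ?_, rfl⟩ ?_
    · rw [D.sum_coupling hz hz', D.pathMeasure_Λ hz]
    · rw [D.sum_coupling' hz hz', D.pathMeasure_Λ hz']
    · rintro s ⟨π, h0, h1, h2, rfl⟩
      have := D.flowDiff_le_of_coupling hm hz hz' h0
        (fun a => (h1 a).trans (D.pathMeasure_Λ hz a))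
        (fun b => (h2 b).trans (D.pathMeasure_Λ hz' b))
      linarith
  linarith

theorem sum_arcProd_endpoint_eq (hr : D.root ∉ X) (q : V → V → ℝ) (x : X) :
    (open Classical in ∑ γ : D.RootPath, if D.endpoint γ = x then arcProd q γ.1 else 0) =
      D.played q x := by
  classical
  have h := D.sum_arcProd_endpoint hr q fun y => if y = x then 1 else 0
  simpa using h

theorem transportCost_played_le [MetricSpace X] (hr : D.root ∉ X) (hD : D.IsExpanding 1)
    {q p : V → V → ℝ} (hq : q ∈ D.states) (hp : p ∈ D.states) :
    transportCost (dist : X → X → ℝ) (D.played q) (D.played p) ≤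
      D.moveDown q p + D.moveUp q p := by
  refine (transportCost_le_of_coupling (e := fun γ : D.RootPath => D.endpoint γ)
    (π := fun γ γ' : D.RootPath => D.coupling q p γ.1 γ'.1) (fun _ _ => dist_nonneg)
    (fun γ γ' => D.coupling_nonneg hq hp γ γ') (fun x => ?_) (fun x => ?_)).trans
    (le_trans (Finset.sum_le_sum fun γ _ => Finset.sum_le_sum fun γ' _ =>
      mul_le_mul_of_nonneg_left ?_ (D.coupling_nonneg hq hp γ γ'))
      (D.sum_coupling_mul_pathDist_le hq hp))
  · simp only [D.sum_coupling hq hp]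
    convert D.sum_arcProd_endpoint_eq hr q x
  · simp only [D.sum_coupling' hq hp]
    convert D.sum_arcProd_endpoint_eq hr p x
  · simpa using hD γ γ'

/-! ### Sums over time -/

theorem flowDiff_comm (z z' : V → V → ℝ) : D.flowDiff z z' = D.flowDiff z' z := by
  simp only [flowDiff, abs_sub_comm]

theorem flowDiff_pos {z z' : V → V → ℝ} {x : X} (h : D.played z x ≠ D.played z' x) :
    0 < D.flowDiff z z' := by
  have h0 (u v : V) (huv : v ∈ D.children u) : 0 ≤ D.ω u v * |D.Λ z u v - D.Λ z' u v| :=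
    mul_nonneg (D.ω_pos u v (D.mem_children.1 huv)).le (abs_nonneg _)
  refine (Finset.sum_nonneg fun u _ => Finset.sum_nonneg (h0 u)).lt_of_ne fun h1 => h ?_
  refine Finset.sum_congr rfl fun u hu => ?_
  have hu := D.mem_parents.1 hu
  have h2 := (Finset.sum_eq_zero_iff_of_nonneg fun u _ => Finset.sum_nonneg (h0 u)).1 h1.symm u
    (Finset.mem_univ u)
  have h3 := (Finset.sum_eq_zero_iff_of_nonneg (h0 u)).1 h2 x (D.mem_children.2 hu)
  exact sub_eq_zero.1 (abs_eq_zero.1 ((mul_eq_zero.1 h3).resolve_left (D.ω_pos u x hu).ne'))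

theorem sum_mul_played_of_played_eq_one (hr : D.root ∉ X) {z : V → V → ℝ} (hz : z ∈ D.states)
    {x : X} (hx : D.played z x = 1) (c : X → ℝ) : ∑ y, c y * D.played z y = c x := by
  rw [Finset.sum_eq_single x (fun y _ hy => by rw [D.played_eq_zero hr hz hx hy, mul_zero])
    (by simp), hx, mul_one]

variable {D}

/-- The Lipschitz property, with the unit flows given by states. -/
theorem IsLipschitz.exists_states [MetricSpace X] {L : ℝ} (hL : D.IsLipschitz L) (T : ℕ)
    (ρ : ℕ → X) : D.root ∉ X ∧ ∃ z : ℕ → V → V → ℝ, (∀ t, z t ∈ D.states) ∧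
      (∀ t ≤ T, D.played (z t) (ρ t) = 1) ∧
      ∑ t ∈ Finset.range T, D.flowW (D.Λ (z t)) (D.Λ (z (t + 1))) ≤
        L * ∑ t ∈ Finset.range T, dist (ρ t) (ρ (t + 1)) := by
  obtain ⟨F, hF, hW⟩ := hL T fun i => ρ i
  choose z hz hzF using fun i => IsUnitFlow.exists_state D (hF i).1
  let Z : ℕ → V → V → ℝ := fun t => if h : t < T + 1 then z ⟨t, h⟩ else D.prior
  have hZ (i : Fin (T + 1)) : Z i = z i := dif_pos i.2
  refine ⟨IsUnitFlow.root_notMem D (hF 0).1, Z, fun t => ?_, fun t ht => ?_, ?_⟩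
  · simp only [Z]
    split_ifs
    · exact hz _
    · exact D.prior_mem_states
  · have h := hZ ⟨t, Nat.lt_succ_of_le ht⟩
    rw [played, h, hzF]
    exact (hF ⟨t, Nat.lt_succ_of_le ht⟩).2
  · rw [Finset.sum_range, Finset.sum_range]
    refine le_trans (Finset.sum_le_sum fun i _ => le_of_eq ?_) hW
    have h1 : Z i = z i.castSucc := hZ i.castSucc
    have h2 : Z (i + 1) = z i.succ := hZ i.succ
    rw [h1, h2, hzF, hzF]

theorem IsLipschitz.pos [MetricSpace X] {L : ℝ} (hL : D.IsLipschitz L) (hX : 1 < X.card)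
    {m : V → ℝ} (hm : D.IsScale m) : 0 < L := by
  obtain ⟨a, ha, b, hb, hab⟩ := Finset.one_lt_card.1 hX
  have hxy : (⟨a, ha⟩ : X) ≠ ⟨b, hb⟩ := fun h => hab (congrArg Subtype.val h)
  obtain ⟨hr, z, hz, hp, hW⟩ := hL.exists_states 1 fun t => if t = 0 then ⟨a, ha⟩ else ⟨b, hb⟩
  have h0 := hp 0 (by norm_num)
  have h1 := hp 1 le_rfl
  simp only [if_true, one_ne_zero, if_false] at h0 h1
  simp only [Finset.sum_range_one, zero_add, if_true, one_ne_zero, if_false] at hW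
  have h2 := D.flowDiff_pos (z := z 0) (z' := z 1) (x := ⟨a, ha⟩)
    (by rw [h0, D.played_eq_zero hr (hz 1) h1 hxy]; exact one_ne_zero)
  have h3 := D.flowDiff_le_flowW hm (hz 0) (hz 1)
  exact pos_of_mul_pos_left (show 0 < L * dist (⟨a, ha⟩ : X) ⟨b, hb⟩ by linarith) dist_nonneg

variable (D)

theorem traj_mem_states {κ : ℝ} (hκ : 0 < κ) {p₀ : V → V → ℝ} (hp₀ : p₀ ∈ D.states)
    (c : ℕ → X → ℝ) (t : ℕ) : D.traj κ p₀ c t ∈ D.states := by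
  induction t with
  | zero => exact hp₀
  | succ t ih => exact D.step_mem_states hκ ih (c t)

/-- The service cost up to a finite time. With `κ = 8 * L`, the increase of the divergence due to
the movement of the comparator is at most the movement cost of the comparator. -/
theorem sum_service_le [MetricSpace X] {m : V → ℝ} (hm : D.IsScale m) {L : ℝ} (hL0 : 0 < L)
    (hL : D.IsLipschitz L) {p₀ : V → V → ℝ} (hp₀ : p₀ ∈ D.states) (c : ℕ → X → ℝ) (ρ : ℕ → X)
    (T : ℕ) :
    ∑ t ∈ Finset.range T, ∑ x, c t x * D.played (D.traj (8 * L) p₀ c (t + 1)) x ≤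
      ∑ t ∈ Finset.range T, (c t (ρ (t + 1)) + dist (ρ t) (ρ (t + 1))) +
        4 / 3 * (5 / (8 * L)) * m D.root := by
  obtain ⟨hr, z, hz, hp, hW⟩ := hL.exists_states T ρ
  have hκ : 0 < 8 * L := by positivity
  have htraj := D.traj_mem_states hκ hp₀ c
  have key (n : ℕ) (hn : n ≤ T) :
      ∑ t ∈ Finset.range n, ∑ x, c t x * D.played (D.traj (8 * L) p₀ c (t + 1)) x +
        D.globalDiv (8 * L) (z n) (D.traj (8 * L) p₀ c n) ≤
      ∑ t ∈ Finset.range n, c t (ρ (t + 1)) +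
        1 / L * ∑ t ∈ Finset.range n, D.flowW (D.Λ (z t)) (D.Λ (z (t + 1))) +
        D.globalDiv (8 * L) (z 0) p₀ := by
    induction n with
    | zero => simp [traj]
    | succ n ih =>
      have h0 := ih (by omega)
      rw [Finset.sum_range_succ, Finset.sum_range_succ, Finset.sum_range_succ, mul_add]
      have h1 := D.globalDiv_step_sub_le hr hκ (hz (n + 1)) (htraj n) (c n)
      rw [D.sum_mul_played_of_played_eq_one hr (hz (n + 1)) (hp (n + 1) hn)] at h1
      have h2 := D.globalDiv_sub_le hm hκ (hz n) (hz (n + 1)) (htraj n)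
      have h3 : 3 / (8 * L) * D.flowDiff (z (n + 1)) (z n) ≤
          1 / L * D.flowW (D.Λ (z n)) (D.Λ (z (n + 1))) := by
        rw [flowDiff_comm]
        calc _ ≤ 3 / (8 * L) * (8 / 3 * D.flowW (D.Λ (z n)) (D.Λ (z (n + 1)))) :=
              mul_le_mul_of_nonneg_left (D.flowDiff_le_flowW hm (hz n) (hz (n + 1)))
                (by positivity)
          _ = _ := by field_simp
      have h4 : D.traj (8 * L) p₀ c (n + 1) = D.step (8 * L) (D.traj (8 * L) p₀ c n) (c n) := rfl
      rw [h4]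
      linarith
  have h1 := key T le_rfl
  have h2 := D.globalDiv_nonneg hκ (hz T) (htraj T)
  have h3 := D.globalDiv_le hm hκ (hz 0) hp₀
  have h4 : 1 / L * ∑ t ∈ Finset.range T, D.flowW (D.Λ (z t)) (D.Λ (z (t + 1))) ≤
      ∑ t ∈ Finset.range T, dist (ρ t) (ρ (t + 1)) := by
    rw [one_div, inv_mul_le_iff₀ hL0]
    exact hW
  rw [Finset.sum_add_distrib]
  linarith

/-- The movement up to a finite time. The smallness of `ε` makes the movement on the right of
`moveDown_step_le` at most nine tenths of the movement on the left. -/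
theorem sum_move_le (hr : D.root ∉ X)
    (hθ : ∀ u v, D.arc u v → D.θ u v = (D.σ v : ℝ) / (D.σ u : ℝ)) {m : V → ℝ}
    (hm : D.IsScale m) {κ : ℝ} (hκ : 0 < κ) {ε R : ℝ} (hε : 0 ≤ ε)
    (hR : ∀ u v, D.arc u v → D.η u v ≤ R * D.ω u v ∧ 2 * D.rank v ≤ R * D.ω u v)
    (hεR : 3 * κ * (ε * R) ≤ 1 / 10) {p₀ : V → V → ℝ} (hp₀ : p₀ ∈ D.states) {c : ℕ → X → ℝ}
    (hc : ∀ t x, 0 ≤ c t x ∧ c t x ≤ ε) (T : ℕ) :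
    ∑ t ∈ Finset.range T, (D.moveDown (D.traj κ p₀ c t) (D.traj κ p₀ c (t + 1)) +
        D.moveUp (D.traj κ p₀ c t) (D.traj κ p₀ c (t + 1))) ≤
      140 / 3 * κ * D.rank D.root *
        ∑ t ∈ Finset.range T, ∑ x, c t x * D.played (D.traj κ p₀ c (t + 1)) x +
        76 * m D.root := by
  have htraj := D.traj_mem_states hκ hp₀ c
  set p := D.traj κ p₀ c with hp
  have hstep (t : ℕ) : D.moveDown (p t) (p (t + 1)) + D.moveUp (p t) (p (t + 1)) ≤
      140 / 3 * κ * D.rank D.root * ∑ x, c t x * D.played (p (t + 1)) x +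
        (70 / 3 * D.priorDiv κ (p (t + 1)) + D.meanLength (p (t + 1)) -
          (70 / 3 * D.priorDiv κ (p t) + D.meanLength (p t))) := by
    have h1 : D.moveDown (p t) (p (t + 1)) ≤
        κ * (2 * D.rank D.root * ∑ x, c t x * D.played (p (t + 1)) x) +
        (D.priorDiv κ (p (t + 1)) - D.priorDiv κ (p t)) +
        (4 / 5 + 3 * κ * (ε * R)) * D.moveDown (p t) (p (t + 1)) :=
      D.moveDown_step_le hr hθ hm hκ hε hR (htraj t) (hc t)
    have h2 := D.moveUp_le hm (htraj t) (htraj (t + 1))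
    have h3 := mul_le_mul_of_nonneg_right hεR (D.moveDown_nonneg (htraj t) (p (t + 1)))
    linarith
  refine (Finset.sum_le_sum fun t _ => hstep t).trans ?_
  rw [Finset.sum_add_distrib, ← Finset.mul_sum,
    Finset.sum_range_sub (fun t => 70 / 3 * D.priorDiv κ (p t) + D.meanLength (p t))]
  have h1 := D.priorDiv_le hm hκ (htraj T)
  have h2 := D.priorDiv_nonneg hκ (htraj 0)
  have h3 := D.meanLength_le hm (htraj T)
  have h4 := D.meanLength_nonneg (htraj 0)
  linarith

theorem tsum_ofReal_le_of_sum_le {f g : ℕ → ℝ} {a b : ℝ} (ha : 0 ≤ a) (hb : 0 ≤ b)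
    (hf : ∀ t, 0 ≤ f t) (hg : ∀ t, 0 ≤ g t)
    (h : ∀ T, ∑ t ∈ Finset.range T, f t ≤ a * ∑ t ∈ Finset.range T, g t + b) :
    ∑' t, ENNReal.ofReal (f t) ≤
      ENNReal.ofReal a * ∑' t, ENNReal.ofReal (g t) + ENNReal.ofReal b := by
  refine ENNReal.tsum_le_of_sum_range_le fun T => ?_
  rw [← ENNReal.ofReal_sum_of_nonneg fun t _ => hf t]
  refine (ENNReal.ofReal_le_ofReal (h T)).trans ?_
  rw [ENNReal.ofReal_add (mul_nonneg ha (Finset.sum_nonneg fun t _ => hg t)) hb,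
    ENNReal.ofReal_mul ha, ENNReal.ofReal_sum_of_nonneg fun t _ => hg t]
  gcongr
  exact ENNReal.sum_le_tsum _

theorem serviceCost_le [MetricSpace X] {m : V → ℝ} (hm : D.IsScale m) {L : ℝ} (hL0 : 0 < L)
    (hL : D.IsLipschitz L) (hr : D.root ∉ X) {p₀ : V → V → ℝ} (hp₀ : p₀ ∈ D.states) (ρ₀ : X)
    {c : ℕ → X → ℝ} (hc : ∀ t x, 0 ≤ c t x) :
    D.serviceCost (8 * L) p₀ c ≤
      offlineCost ρ₀ c + ENNReal.ofReal (4 / 3 * (5 / (8 * L)) * m D.root) := by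
  have hκ : 0 < 8 * L := by positivity
  have hm0 := hm.1 D.root
  unfold offlineCost
  rw [ENNReal.iInf_add]
  refine le_iInf fun ρ => ?_
  by_cases hρ : ρ 0 = ρ₀
  · simp only [hρ, iInf_pos]
    have := tsum_ofReal_le_of_sum_le (a := 1) zero_le_one
      (b := 4 / 3 * (5 / (8 * L)) * m D.root) (by positivity)
      (fun t => Finset.sum_nonneg fun x _ => mul_nonneg (hc t x)
        (D.played_nonneg hr (D.traj_mem_states hκ hp₀ c (t + 1)) x))
      (fun t => add_nonneg (hc t (ρ (t + 1))) dist_nonneg)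
      (fun T => by
        rw [one_mul]
        exact D.sum_service_le hm hL0 hL hp₀ c ρ T)
    rw [ENNReal.ofReal_one, one_mul] at this
    exact this
  · simp [hρ]

end MarkedDAG

end

universe u

theorem theorem4p2 :
    ∃ a b C : ℝ, 0 < a ∧ 0 < b ∧ 0 < C ∧
      ∀ (V : Type u) [Fintype V] (X : Finset V) [MetricSpace X] (D : MarkedDAG X) (τ L : ℝ),
        1 < X.card → 4 ≤ τ → D.IsGeometric τ →
        (∀ u v, D.arc u v → D.θ u v = (D.σ v : ℝ) / (D.σ u : ℝ)) →
        D.IsExpanding 1 → D.IsLipschitz L →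
        ∃ κ : ℝ, 0 < κ ∧ a * L ≤ κ ∧ κ ≤ b * L ∧ ∃ ε : ℝ, 0 < ε ∧
          ∀ p₀ ∈ D.states, ∀ ρ₀ : X, ∃ β : ℝ, 0 < β ∧
            ∀ c : ℕ → X → ℝ, (∀ t x, 0 ≤ c t x ∧ c t x ≤ ε) →
              D.serviceCost κ p₀ c ≤ offlineCost ρ₀ c + ENNReal.ofReal β ∧
              D.movementCost κ p₀ c ≤
                ENNReal.ofReal (C * (L * (D.depth + Real.log (Fintype.card D.RootPath)))) *
                  offlineCost ρ₀ c + ENNReal.ofReal β ∧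
              D.metricMovementCost κ p₀ c ≤
                ENNReal.ofReal (C * (L * (D.depth + Real.log (Fintype.card D.RootPath)))) *
                  offlineCost ρ₀ c + ENNReal.ofReal β := by
  refine ⟨8, 8, 400, by norm_num, by norm_num, by norm_num, ?_⟩
  intro V _ X _ D τ L hX hτ hgeo hθ hexp hL
  obtain ⟨m, hm⟩ := hgeo.exists_isScale hτ
  have hL0 := hL.pos hX hm
  have hκ : 0 < 8 * L := by positivity
  obtain ⟨R, hR0, hR⟩ := D.exists_ratio_bound
  refine ⟨8 * L, hκ, le_rfl, le_rfl, 1 / (30 * (8 * L) * (R + 1)), by positivity, ?_⟩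
  intro p₀ hp₀ ρ₀
  have hr : D.root ∉ X := (hL.exists_states 0 fun _ => ρ₀).1
  have hm0 := hm.1 D.root
  have hrank := D.rank_nonneg D.root
  set B := 4 / 3 * (5 / (8 * L)) * m D.root with hB
  set a := 400 * (L * D.rank D.root) with ha
  have hB0 : 0 ≤ B := by positivity
  have ha0 : 0 ≤ a := by positivity
  refine ⟨B + (a * B + 76 * m D.root) + 1, by positivity, fun c hc => ?_⟩
  have hserv : D.serviceCost (8 * L) p₀ c ≤ offlineCost ρ₀ c + ENNReal.ofReal B :=
    D.serviceCost_le hm hL0 hL hr hp₀ ρ₀ fun t x => (hc t x).1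
  have htraj := D.traj_mem_states hκ hp₀ c
  have hserv0 (t : ℕ) : 0 ≤ ∑ x, c t x * D.played (D.traj (8 * L) p₀ c (t + 1)) x :=
    Finset.sum_nonneg fun x _ => mul_nonneg (hc t x).1 (D.played_nonneg hr (htraj (t + 1)) x)
  -- Both movement costs are at most the movement along the arcs.
  have hmove {f : ℕ → ℝ} (hf : ∀ t, f t ≤
      D.moveDown (D.traj (8 * L) p₀ c t) (D.traj (8 * L) p₀ c (t + 1)) +
      D.moveUp (D.traj (8 * L) p₀ c t) (D.traj (8 * L) p₀ c (t + 1))) :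
      ∑' t, ENNReal.ofReal (f t) ≤ ENNReal.ofReal a * offlineCost ρ₀ c +
        ENNReal.ofReal (B + (a * B + 76 * m D.root) + 1) := by
    have h1 : ∑' t, ENNReal.ofReal (f t) ≤
        ENNReal.ofReal a * D.serviceCost (8 * L) p₀ c + ENNReal.ofReal (76 * m D.root) := by
      refine (ENNReal.tsum_le_tsum fun t => ENNReal.ofReal_le_ofReal
        ((hf t).trans (le_max_left _ 0))).trans
        (MarkedDAG.tsum_ofReal_le_of_sum_le ha0 (by positivity) (fun t => le_max_right _ _)
          hserv0 fun T => ?_)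
      have h2 := D.sum_move_le hr hθ hm hκ (ε := 1 / (30 * (8 * L) * (R + 1))) (by positivity) hR
        (by
          have : 3 * (8 * L) * (1 / (30 * (8 * L) * (R + 1)) * R) = 1 / 10 * (R / (R + 1)) := by
            field_simp; ring
          rw [this]
          have : R / (R + 1) ≤ 1 := (div_le_one (by positivity)).2 (by linarith)
          linarith) hp₀ hc T
      have h3 := mul_nonneg (mul_nonneg hL0.le hrank)
        (Finset.sum_nonneg fun t (_ : t ∈ Finset.range T) => hserv0 t)
      have h4 (t : ℕ) := max_eq_left (add_nonneg (D.moveDown_nonneg (htraj t)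
        (D.traj (8 * L) p₀ c (t + 1))) (D.moveUp_nonneg (htraj t)
        (D.traj (8 * L) p₀ c (t + 1))))
      simp only [h4]
      rw [ha]
      linarith
    calc _ ≤ ENNReal.ofReal a * (offlineCost ρ₀ c + ENNReal.ofReal B) +
          ENNReal.ofReal (76 * m D.root) := h1.trans (by gcongr)
      _ = ENNReal.ofReal a * offlineCost ρ₀ c + ENNReal.ofReal (a * B + 76 * m D.root) := by
          rw [mul_add, ← ENNReal.ofReal_mul ha0, add_assoc,
            ← ENNReal.ofReal_add (by positivity) (by positivity)]
      _ ≤ _ := add_le_add le_rfl (ENNReal.ofReal_le_ofReal (by linarith))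
  refine ⟨hserv.trans ?_, hmove fun t => D.flowW_Λ_le (htraj t) (htraj (t + 1)),
    hmove fun t => D.transportCost_played_le hr hexp (htraj t) (htraj (t + 1))⟩
  gcongr
  have : 0 ≤ a * B := by positivity
  linarith
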